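/- Identify the plane with $\mathbb{C}$. Let $KS_0$ be the equilateral triangle with vertices $0,1,e^{i\pi/3}$ and base $I=[0,1]$, and let $KS_{n+1}$ be obtained from $KS_n$ by replacing the open middle third of each of its $3\cdot 4^n$ sides by the other two sides of the equilateral triangle erected outward on it. Let $\Omega(KS_n)$ be the closed region bounded by $KS_n$, regarded as a billiard table. For an inward pointing direction $\theta$ (measured in the fixed coordinate system of the plane) at a non-vertex point $x\in KS_n$, let $\mathscr{O}_n(x,\theta)$ be the orbit of $(x,\theta)$ under the billiard map of $\Omega(KS_n)$ (collision points together with inward pointing directions); it is periodic if it never hits a vertex and returns to $(x,\theta)$. A point $x_n\in KS_n$ is compatible with $x_0\in KS_0$ in direction $\theta$ if $x_0=x_n+te^{i\theta}$ for some $t\ge 0$ and the open segment between $x_n$ and $x_0$ lies in $\Omega(KS_n)\setminus KS_n$. A sequence $\{\mathscr{O}_n(x_n,\theta)\}_{n\ge0}$ is a compatible sequence of periodic orbits if, for all $n\ge 0$, $x_n$ is compatible with $x_0$ in direction $\theta$, $\theta$ is inward pointing at $x_n$, and $\mathscr{O}_n(x_n,\theta)$ is periodic. For a side $s_{N,k}$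 of $KS_N$, let $\mathscr{C}'_{N,k}\subset s_{N,k}$ be the image, under an affine bijection $[0,1]\to s_{N,k}$, of the set of those points of the ternary Cantor set that have a ternary expansion with infinitely many $0$'s and infinitely many $2$'s. **Proposition.** Let $N\ge 0$, let $s_{N,k}$ be a side of $KS_N$, let $y\in\mathscr{C}'_{N,k}$, and let $\theta$ be an integer multiple of $\pi/3$ that is inward pointing at $y$. Then there is a sequence of points $x_n\in KS_n$ ($n\ge 0$) such that: 1. $x_0\in I$ has a ternary expansion with finitely many $1$'s, infinitely many $0$'s and infinitely many $2$'s; 2. $\{\mathscr{O}_n(x_n,\pi/3)\}_{n\ge 0}$ is a compatible sequence of periodic orbits (in particular $x_N$ is compatible with $x_0$ in direction $\pi/3$); 3. this sequence is eventually constant: there is $M\geq 0$ with $\mathscr{O}_n(x_n,\pi/3)=\mathscr{O}_M(x_M,\pi/3)$ for all $n\ge M$. Thus, for $n\geq M$, $\mathscr{O}_n(x_n,\pi/3)$ is a stabilizing orbit (or $\mathscr{C}$-orbit), i.e. an orbit at or after the index of stabilization in a compatible sequence of periodic orbits in direction $\pi/3$ whose first basepoint is as in 1 and which is eventually constant; 4.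 the orbit of $(y,\theta)$ belongs to the sequence, at level $N$: $\mathscr{O}_N(y,\theta)$ is periodic, and it has the same path and the same set of collision points as $\mathscr{O}_N(x_N,\pi/3)$. If moreover $\theta\in\{\pi/3,\pi,5\pi/3\}$ modulo $2\pi$, then $\mathscr{O}_N(y,\theta)=\mathscr{O}_N(x_N,\pi/3)$ also as sets of points with directions. (For the other inward multiples of $\pi/3$ the path is run through in the opposite sense.) -/

import Mathlib

namespace KochBilliard

open Complex

noncomputable section

/-- The unit vector of the plane (identified with `ℂ`) making the angle `j * π / 3` with the
positive horizontal axis. -/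
def dir (j : ℤ) : ℂ := exp (((j : ℂ) * (Real.pi : ℂ) / 3) * I)

/-- The vertices of the `n`-th prefractal Koch snowflake polygon, listed counterclockwise and
periodically with period `3 * 4 ^ n`. Level `0` is the equilateral triangle with vertices
`0, 1, exp (i π / 3)`. At each further level every side `[a, b]` is replaced by four sides: its
middle third is removed, and the other two sides of the outward equilateral triangle (the table
lies to the left of a side, so outward is to the right) erected on it are added. -/
def vertex : ℕ → ℕ → ℂ
  | 0, k => if k % 3 = 0 then 0 else if k % 3 = 1 then 1 else dir 1
  | n + 1, k =>
    let a := vertex n (k / 4)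
    let b := vertex n (k / 4 + 1)
    if k % 4 = 0 then a
    else if k % 4 = 1 then a + (b - a) / 3
    else if k % 4 = 2 then a + (b - a) / 3 + dir (-1) * ((b - a) / 3)
    else a + 2 * ((b - a) / 3)

/-- The side vector of the `k`-th side of the `n`-th polygon, `0 ≤ k < 3 * 4 ^ n`. -/
def sideVec (n k : ℕ) : ℂ := vertex n (k + 1) - vertex n k

/-- The `k`-th closed side of the `n`-th polygon. -/
def side (n k : ℕ) : Set ℂ := segment ℝ (vertex n k) (vertex n (k + 1))

/-- The `k`-th side of the `n`-th polygon without its two end points. -/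
def openSide (n k : ℕ) : Set ℂ := openSegment ℝ (vertex n k) (vertex n (k + 1))

/-- The `n`-th prefractal Koch snowflake curve `KS_n`. -/
def curve (n : ℕ) : Set ℂ := ⋃ k ∈ Finset.range (3 * 4 ^ n), side n k

/-- The triangular cell glued to the `k`-th side of the `n`-th polygon when passing to level
`n + 1`. -/
def cell (n k : ℕ) : Set ℂ :=
  convexHull ℝ {vertex (n + 1) (4 * k + 1), vertex (n + 1) (4 * k + 2),
    vertex (n + 1) (4 * k + 3)}

/-- The billiard table `Ω(KS_n)`: the closed region bounded by `KS_n`. -/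
def table : ℕ → Set ℂ
  | 0 => convexHull ℝ {vertex 0 0, vertex 0 1, vertex 0 2}
  | n + 1 => table n ∪ ⋃ k ∈ Finset.range (3 * 4 ^ n), cell n k

/-- The open billiard table: points of `Ω(KS_n)` not on the boundary `KS_n`. -/
def openTable (n : ℕ) : Set ℂ := table n \ curve n

/-- `x` is a point of `KS_n`, not a vertex, and `d` points into the table at `x`
(the polygon is traversed counterclockwise, so inward is to the left of the side). -/
def IsInward (n : ℕ) (x d : ℂ) : Prop :=
  ∃ k < 3 * 4 ^ n, x ∈ openSide n k ∧ 0 < (starRingEnd ℂ (sideVec n k) * d).im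

/-- Reflection of the vector `d` in the line spanned by `s ≠ 0`. -/
def reflect (s d : ℂ) : ℂ := s / starRingEnd ℂ s * starRingEnd ℂ d

/-- The graph of the billiard map `f_n`. A phase point `(x, d)` is a base point on `KS_n` with the
inward pointing representative `d` of its direction. The ball leaves `p.1` in the direction `p.2`,
travels inside the table up to the first collision point `q.1` with `KS_n`, and its direction is
then reflected in the side that is hit. No step is defined when the ball runs into a vertex. -/
def Step (n : ℕ) (p q : ℂ × ℂ) : Prop :=
  ∃ T : ℝ, 0 < T ∧ q.1 = p.1 + (T : ℂ) * p.2 ∧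
    (∀ t : ℝ, 0 < t → t < T → p.1 + (t : ℂ) * p.2 ∈ openTable n) ∧
    ∃ k < 3 * 4 ^ n, q.1 ∈ openSide n k ∧ q.2 = reflect (sideVec n k) p.2

/-- The orbit of the initial condition `p` under the billiard map of `Ω(KS_n)`. -/
def orbit (n : ℕ) (p : ℂ × ℂ) : Set (ℂ × ℂ) := {q | Relation.ReflTransGen (Step n) p q}

/-- The footprint of an orbit: its set of collision points. -/
def footprint (n : ℕ) (p : ℂ × ℂ) : Set ℂ := Prod.fst '' orbit n p

/-- The path traced out by the billiard ball along the orbit of `p`. -/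
def path (n : ℕ) (p : ℂ × ℂ) : Set ℂ :=
  {z | ∃ q ∈ orbit n p, ∃ q', Step n q q' ∧ z ∈ segment ℝ q.1 q'.1}

/-- The orbit of `p` is periodic: it never runs into a vertex, and some positive iterate of the
billiard map brings `p` back to itself. -/
def IsPeriodicOrbit (n : ℕ) (p : ℂ × ℂ) : Prop := Relation.TransGen (Step n) p p

/-- `x` on `KS_n` is compatible with `x₀` in the direction `d`: moving from `x` in the direction
`d` one arrives at `x₀`, staying inside the open table on the way (if `x = x₀` there is nothing in
between). -/
def IsCompatible (n : ℕ) (d x₀ x : ℂ) : Prop :=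
  x ∈ curve n ∧ ∃ T : ℝ, 0 ≤ T ∧ x₀ = x + (T : ℂ) * d ∧
    ∀ t : ℝ, 0 < t → t < T → x + (t : ℂ) * d ∈ openTable n

/-- `(x n, d)`, `n = 0, 1, 2, …`, is a compatible sequence of initial conditions. -/
def IsCompatibleSeq (d : ℂ) (x : ℕ → ℂ) : Prop :=
  ∀ n, IsCompatible n d (x 0) (x n) ∧ IsInward n (x n) d

/-- The orbits of `(x n, d)` in `Ω(KS_n)` form a compatible sequence of periodic orbits. -/
def IsCompatiblePeriodicSeq (d : ℂ) (x : ℕ → ℂ) : Prop :=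
  IsCompatibleSeq d x ∧ ∀ n, IsPeriodicOrbit n (x n, d)

/-- The sequence of orbits of `(x n, d)` in `Ω(KS_n)` is constant from the index `M` on. -/
def IsConstantFrom (d : ℂ) (x : ℕ → ℂ) (M : ℕ) : Prop :=
  ∀ n, M ≤ n → orbit n (x n, d) = orbit M (x M, d)

/-- `z` is a point of the base `I = [0, 1]` of the triangle with a ternary expansion consisting of
finitely many `1`s, infinitely many `0`s and infinitely many `2`s. -/
def IsCantorBase (z : ℂ) : Prop :=
  ∃ a : ℕ → Fin 3, z = ((Real.ofDigits a : ℝ) : ℂ) ∧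
    {i | a i = 1}.Finite ∧ {i | a i = 0}.Infinite ∧ {i | a i = 2}.Infinite

/-- `O` is a stabilizing orbit (`C`-orbit) of `Ω(KS_n)`: it is a member of a compatible sequence of
periodic orbits in the direction `π / 3` whose first base point is as in `IsCantorBase`, and the
sequence is already constant from the index `n` on. -/
def IsStabilizingOrbit (n : ℕ) (O : Set (ℂ × ℂ)) : Prop :=
  ∃ x : ℕ → ℂ, IsCantorBase (x 0) ∧ IsCompatiblePeriodicSeq (dir 1) x ∧
    IsConstantFrom (dir 1) x n ∧ O = orbit n (x n, dir 1)

/-- The points of the ternary Cantor set having a ternary expansion with infinitely many `0`s and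
infinitely many `2`s. -/
def cantorPrime : Set ℝ :=
  {u | u ∈ cantorSet ∧ ∃ a : ℕ → Fin 3, u = Real.ofDigits a ∧
    {i | a i = 0}.Infinite ∧ {i | a i = 2}.Infinite}

/-- The copy `C'_{n,k}` of `cantorPrime` on the `k`-th side of `KS_n`. -/
def sideCantorPrime (n k : ℕ) : Set ℂ :=
  (fun u : ℝ => vertex n k + (u : ℂ) * sideVec n k) '' cantorPrime

end

end KochBilliard

/-! The table `Ω(KS_n)` is a union of tiles of the triangular lattice of mesh `3 ^ (-n)`, and the
sides of `KS_n` are lattice edges. A ball moving in one of the directions `π/3`, `π`, `5π/3` keeps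
to these three under reflection. One lattice coordinate is constant along each flight; its
fractional part `v` fixes where edges are crossed, and a reflection changes it to `1 - v`. So the
billiard becomes the map `flow` on triples (tile, direction, `v`). For given `v` up to `v ↦ 1 - v`
there are finitely many triples, and `flow` is injective on them; hence every orbit is periodic and
reachability is symmetric (`exists_period`, `Reaches.symm`).

The heart is that every orbit crosses the base `I` in direction `π/3` (`exists_reaches_base`). By
induction on the number of refinements, a ball that leaves a coarser table through one of its sides
comes back through that side in the direction a reflection would have given it (`exists_return`): if
it gets into the glued cell, it is turned back, again in this coarse sense, at both free sides of
the cell, and two turns there amount to one turn outside. The fine billiard therefore shadows the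
coarse one. The ball gets out of every glued cell (`exists_reaches_root`) and then runs around the
central triangle.

Hence the orbit of `y`, which has parameter `u` on its side, crosses `I` at a point `x₀ = (p + v) /
3 ^ N` with `v = u` or `v = 1 - u`; the expansion of `x₀` is that of `p` followed by digits `0` and
`2`. Going back from `x₀` against `π/3` to the boundary gives `x_N` on the same orbit. For `n < N`
the same construction in the coarser table gives `x_n`, since `x₀` is never a lattice point. For `n
≥ N` the orbit does not change (`orbit_persists`): all collision points have parameter `u` or `1 -
u`, so each lies in an outer third of its side at every refinement, and the open tables increase.
The inward multiples of `π/3` outside the three directions are treated by time reversal (`Rev`). -/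

namespace KochBilliard

/-! ### Tiles of the triangular lattice and refinement by the factor three -/

/-- A triangle of the unit triangular lattice, recorded by the integer parts of the three
coordinates `a, b, c` (with `a + b + c = 0`) of its interior points. -/
@[ext] structure Tile where
  p : ℤ
  q : ℤ
  r : ℤ

namespace Tile

/-- Add `x, y, z` to the coordinates with index `d, d + 1, d + 2`. -/
def add (t : Tile) (d : Fin 3) (x y z : ℤ) : Tile :=
  match d with
  | 0 => ⟨t.p + x, t.q + y, t.r + z⟩
  | 1 => ⟨t.p + z, t.q + x, t.r + y⟩
  | 2 => ⟨t.p + y, t.q + z, t.r + x⟩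

/-- The coordinate with index `d`. -/
def get (t : Tile) (d : Fin 3) : ℤ :=
  match d with
  | 0 => t.p
  | 1 => t.q
  | 2 => t.r

/-- The sum of the coordinates: `-1` for upward tiles and `-2` for downward tiles. -/
def sum (t : Tile) : ℤ := t.p + t.q + t.r

/-- The triples that are tiles. -/
def Valid (t : Tile) : Prop := t.sum = -1 ∨ t.sum = -2

/-- The tile entered when leaving `t` in direction `d`. -/
def nxt (t : Tile) (d : Fin 3) : Tile := t.add d 0 (-1 - t.sum) (-2 - t.sum)

/-- The tile from which `t` is entered in direction `d`. -/
def prv (t : Tile) (d : Fin 3) : Tile := t.add d 0 (-2 - t.sum) (-1 - t.sum)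

/-- The direction after reflection in the side through which direction `d` leaves `t`. -/
def turn (t : Tile) (d : Fin 3) : Fin 3 := if t.sum = -1 then d + 1 else d + 2

/-- The tile of the three times coarser lattice containing `t`. -/
def par (t : Tile) : Tile := ⟨t.p / 3, t.q / 3, t.r / 3⟩

/-- `t` is the middle one of the three subtiles of `par t` along the side where direction `d`
enters. -/
def IsMid (t : Tile) (d : Fin 3) : Prop :=
  t.get d % 3 = 1 ∧ t.get (d + 1) % 3 = -1 - t.sum ∧ t.get (d + 2) % 3 = - t.sum

/-- All coordinates are multiplied by three. -/
def scale (t : Tile) : Tile := ⟨3 * t.p, 3 * t.q, 3 * t.r⟩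

/-- The subtile glued outside to the middle third of the side where direction `d` enters `t`. -/
def glue (t : Tile) (d : Fin 3) : Tile := t.scale.add d 1 (-3 - 2 * t.sum) (-1 - 2 * t.sum)

/-- The subtile of `t` at the beginning of the side where direction `d` enters `t`. -/
def subFst (t : Tile) (d : Fin 3) : Tile := t.scale.add d 0 (-2 - 2 * t.sum) 2

/-- The subtile of `t` at the end of the side where direction `d` enters `t`. -/
def subLst (t : Tile) (d : Fin 3) : Tile := t.scale.add d 2 0 (-2 - 2 * t.sum)

end Tile

open Tile

/-- The tiles that make up the `n`-th table. -/
def Tri : ℕ → Tile → Prop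
  | 0, t => t = ⟨0, 0, -1⟩
  | n + 1, t => t.Valid ∧ (Tri n t.par ∨ ∃ d, t.IsMid d ∧ Tri n (t.prv d).par)

/-- The tile to the left of a side, together with the direction entering it through the side. -/
def sideState : ℕ → ℕ → Tile × Fin 3
  | 0, k => (⟨0, 0, -1⟩, if k % 3 = 0 then 0 else if k % 3 = 1 then 1 else 2)
  | n + 1, k =>
    let t := (sideState n (k / 4)).1
    let d := (sideState n (k / 4)).2
    if k % 4 = 0 then (t.subFst d, d)
    else if k % 4 = 1 then (t.glue d, if t.sum = -1 then d else d + 2)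
    else if k % 4 = 2 then (t.glue d, if t.sum = -1 then d + 1 else d)
    else (t.subLst d, d)

theorem Tri.valid {n : ℕ} {t : Tile} (h : Tri n t) : t.Valid := by
  cases n with
  | zero => obtain rfl : t = ⟨0, 0, -1⟩ := h; simp [Valid, Tile.sum]
  | succ n => exact h.1

namespace Tile

theorem Valid.nxt {t : Tile} (h : t.Valid) (d : Fin 3) : (t.nxt d).Valid := by
  fin_cases d <;> simp only [Valid, Tile.nxt, sum, add] at * <;> omega

theorem Valid.prv {t : Tile} (h : t.Valid) (d : Fin 3) : (t.prv d).Valid := by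
  fin_cases d <;> simp only [Valid, Tile.prv, sum, add] at * <;> omega

theorem Valid.par {t : Tile} (h : t.Valid) : t.par.Valid := by
  simp only [Valid, Tile.par, sum] at *; omega

theorem sum_nxt (t : Tile) (d : Fin 3) : (t.nxt d).sum = -3 - t.sum := by
  fin_cases d <;> simp only [Tile.nxt, sum, add] <;> omega

theorem sum_prv (t : Tile) (d : Fin 3) : (t.prv d).sum = -3 - t.sum := by
  fin_cases d <;> simp only [Tile.prv, sum, add] <;> omega

theorem prv_nxt (t : Tile) (d : Fin 3) : (t.nxt d).prv d = t := by
  fin_cases d <;> simp only [Tile.nxt, Tile.prv, sum, add, Tile.ext_iff] <;> omega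

theorem nxt_prv (t : Tile) (d : Fin 3) : (t.prv d).nxt d = t := by
  fin_cases d <;> simp only [Tile.nxt, Tile.prv, sum, add, Tile.ext_iff] <;> omega

/-- A reflected ball starts again from the side that it has hit, so the tile beyond this side lies
ahead for the old direction and behind for the new one. -/
theorem prv_turn {t : Tile} (h : t.Valid) (d : Fin 3) : t.prv (t.turn d) = t.nxt d := by
  rcases h with h | h <;> fin_cases d <;> simp [Tile.nxt, Tile.prv, turn, h, add]

theorem turn_injective (t : Tile) : Function.Injective t.turn := by
  intro d e h
  unfold turn at h
  split_ifs at h <;> simpa using h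

/-- The edge that is crossed is either interior to the coarse tile or part of its boundary. Subtiles
touching the boundary along an edge have the orientation of the coarse tile. -/
theorem par_nxt {t : Tile} (h : t.Valid) (d : Fin 3) :
    (t.nxt d).par = t.par ∨ ((t.nxt d).par = t.par.nxt d ∧ t.sum = t.par.sum) := by
  fin_cases d <;> simp only [Valid, Tile.nxt, sum, add, Tile.par, Tile.ext_iff] at * <;> omega

theorem par_prv {t : Tile} (h : t.Valid) (d : Fin 3) :
    (t.prv d).par = t.par ∨ ((t.prv d).par = t.par.prv d ∧ t.sum = t.par.sum) := by
  fin_cases d <;> simp only [Valid, Tile.prv, sum, add, Tile.par, Tile.ext_iff] at * <;> omega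

theorem nxt_ne (t : Tile) (d : Fin 3) : t.nxt d ≠ t := by
  fin_cases d <;> simp only [Tile.nxt, sum, add, ne_eq, Tile.ext_iff] <;> omega

theorem prv_ne (t : Tile) (d : Fin 3) : t.prv d ≠ t := by
  fin_cases d <;> simp only [Tile.prv, sum, add, ne_eq, Tile.ext_iff] <;> omega

theorem isMid_iff {t : Tile} (d : Fin 3) : t.IsMid d ↔
    match d with
    | 0 => t.p % 3 = 1 ∧ t.q % 3 = -1 - t.sum ∧ t.r % 3 = - t.sum
    | 1 => t.q % 3 = 1 ∧ t.r % 3 = -1 - t.sum ∧ t.p % 3 = - t.sum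
    | 2 => t.r % 3 = 1 ∧ t.p % 3 = -1 - t.sum ∧ t.q % 3 = - t.sum := by
  fin_cases d <;> rfl

theorem IsMid.sum_par {t : Tile} {d : Fin 3} (h : t.Valid) (hm : t.IsMid d) :
    t.par.sum = t.sum := by
  rw [isMid_iff] at hm
  fin_cases d <;> simp only [Valid, sum, Tile.par] at * <;> omega

theorem IsMid.par_prv {t : Tile} {d : Fin 3} (h : t.Valid) (hm : t.IsMid d) :
    (t.prv d).par = t.par.prv d := by
  rw [isMid_iff] at hm
  fin_cases d <;> simp only [Valid, Tile.par, Tile.prv, sum, add, Tile.ext_iff] at * <;> omega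

theorem IsMid.par_prv_of_ne {t : Tile} {d e : Fin 3} (h : t.Valid) (hm : t.IsMid d)
    (hne : e ≠ d) : (t.prv e).par = t.par := by
  rw [isMid_iff] at hm
  fin_cases d <;> fin_cases e <;> (try exact absurd rfl hne) <;>
   simp only [Valid, Tile.par, Tile.prv, sum, add, Tile.ext_iff] at * <;> omega

/-- A middle subtile has the orientation of its parent, while its neighbours inside the parent have
the opposite one. -/
theorem IsMid.not_isMid_prv {t : Tile} {d e f : Fin 3} (h : t.Valid) (hm : t.IsMid d)
    (hne : e ≠ d) : ¬ (t.prv e).IsMid f := by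
  intro hf
  have h1 := hm.sum_par h
  have h2 := hf.sum_par (h.prv e)
  have h3 := sum_prv t e
  rw [hm.par_prv_of_ne h hne] at h2
  omega

/-- The direction entering the neighbour through the side where direction `d` enters `t`. -/
def baseDir (t : Tile) (d : Fin 3) : Fin 3 := if t.sum = -1 then d + 2 else d + 1

/-- `IsMid` describes a glued cell from the coarse tile that contains it, `glue` from the tile on
the other side of the edge; the two descriptions agree. -/
theorem IsMid.eq_glue {t : Tile} {d : Fin 3} (h : t.Valid) (hm : t.IsMid d) :
    t = (t.par.prv d).glue (t.baseDir d) := by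
  rw [isMid_iff] at hm
  rcases h with h | h <;> fin_cases d <;>
    simp [baseDir, h, glue, scale, add, Tile.prv, Tile.par, Tile.ext_iff] <;>
    simp [h] at hm <;> simp only [sum] at * <;> omega

theorem IsMid.eq_of_ne {t : Tile} {d e : Fin 3} (h : t.Valid) (hm : t.IsMid d) (hne : e ≠ d) :
    e = (if (t.par.prv d).sum = -1 then t.baseDir d else t.baseDir d + 2) ∨
    e = (if (t.par.prv d).sum = -1 then t.baseDir d + 1 else t.baseDir d) := by
  rw [sum_prv, hm.sum_par h]
  clear hm
  rcases h with h | h <;> simp [baseDir, h] <;> clear h <;> revert hne <;> revert d e <;> decide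

theorem par_subFst {t : Tile} (h : t.Valid) (d : Fin 3) : (t.subFst d).par = t := by
  fin_cases d <;> simp only [Valid, Tile.par, subFst, scale, sum, add, Tile.ext_iff] at * <;> omega

theorem par_subLst {t : Tile} (h : t.Valid) (d : Fin 3) : (t.subLst d).par = t := by
  fin_cases d <;> simp only [Valid, Tile.par, subLst, scale, sum, add, Tile.ext_iff] at * <;> omega

theorem sum_subFst (t : Tile) (d : Fin 3) : (t.subFst d).sum = t.sum := by
  fin_cases d <;> simp only [subFst, scale, sum, add] <;> omega

theorem sum_subLst (t : Tile) (d : Fin 3) : (t.subLst d).sum = t.sum := by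
  fin_cases d <;> simp only [subLst, scale, sum, add] <;> omega

theorem sum_glue (t : Tile) (d : Fin 3) : (t.glue d).sum = -3 - t.sum := by
  fin_cases d <;> simp only [glue, scale, sum, add] <;> omega

theorem par_glue {t : Tile} (h : t.Valid) (d : Fin 3) : (t.glue d).par = t.prv d := by
  fin_cases d <;> simp only [Valid, Tile.par, glue, scale, sum, add, Tile.prv, Tile.ext_iff] at * <;>
    omega

theorem par_prv_subFst {t : Tile} (h : t.Valid) (d : Fin 3) :
    ((t.subFst d).prv d).par = t.prv d := by
  fin_cases d <;> simp only [Valid, Tile.par, subFst, scale, sum, add, Tile.prv, Tile.ext_iff] at * <;>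
    omega

theorem par_prv_subLst {t : Tile} (h : t.Valid) (d : Fin 3) :
    ((t.subLst d).prv d).par = t.prv d := by
  fin_cases d <;> simp only [Valid, Tile.par, subLst, scale, sum, add, Tile.prv, Tile.ext_iff] at * <;>
    omega

theorem not_isMid_prv_subFst {t : Tile} (h : t.Valid) (d e : Fin 3) :
    ¬ ((t.subFst d).prv d).IsMid e := by
  rw [isMid_iff]
  fin_cases d <;> fin_cases e <;> simp only [Valid, subFst, scale, sum, add, Tile.prv] at * <;>
    omega

theorem not_isMid_prv_subLst {t : Tile} (h : t.Valid) (d e : Fin 3) :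
    ¬ ((t.subLst d).prv d).IsMid e := by
  rw [isMid_iff]
  fin_cases d <;> fin_cases e <;> simp only [Valid, subLst, scale, sum, add, Tile.prv] at * <;>
    omega

theorem isMid_glue {t : Tile} (h : t.Valid) (d : Fin 3) : (t.glue d).IsMid (t.baseDir d) := by
  rw [isMid_iff]
  rcases h with h | h <;> fin_cases d <;> simp [baseDir, h] <;>
    simp [glue, scale, add, sum] <;> simp only [sum] at h <;> omega

theorem prv_baseDir {t : Tile} (h : t.Valid) (d : Fin 3) : (t.prv d).prv (t.baseDir d) = t := by
  rcases h with h | h <;> fin_cases d <;> simp [baseDir, h] <;>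
    simp [add, sum, Tile.prv, Tile.ext_iff] <;> simp only [sum] at h <;> omega

theorem par_prv_glue {t : Tile} (h : t.Valid) (d : Fin 3) :
    ((t.glue d).prv (t.baseDir d)).par = t := by
  rw [(isMid_glue h d).par_prv (by have := sum_glue t d; unfold Valid at *; omega), par_glue h,
    prv_baseDir h]

/-- Three subtiles touch a coarse side along an edge. Only across the middle one is there room for a
glued cell, so in the other two cases the edge stays a side of the polygon. -/
theorem eq_subFst_or_subLst {t : Tile} (h : t.Valid) {d : Fin 3}
    (hd : (t.prv d).par = t.par.prv d) :
    t = t.par.subFst d ∨ t = t.par.subLst d ∨ (t.prv d).IsMid (t.baseDir d) := by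
  rw [isMid_iff]
  rcases h with h | h <;> fin_cases d <;> simp [baseDir, h] <;>
    simp only [subFst, subLst, scale, add, sum, Tile.prv, Tile.par, Tile.ext_iff] at * <;> omega

end Tile

/-! ### Sides of the polygon as boundary edges of the tiling -/

/-- The two free edges of a glued cell are boundary: the tile beyond lies in the same missing coarse
tile and is not a middle subtile itself. -/
theorem not_tri_prv_of_isMid {n : ℕ} {t : Tile} {d e : Fin 3} (h : t.Valid) (hm : t.IsMid d)
    (hp : ¬ Tri n t.par) (hne : e ≠ d) : ¬ Tri (n + 1) (t.prv e) := by
  rintro ⟨-, h1 | ⟨f, hf, -⟩⟩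
  · rw [hm.par_prv_of_ne h hne] at h1; exact hp h1
  · exact hm.not_isMid_prv h hne hf

/-- The sides of the `n`-th polygon are boundary edges of the `n`-th table. -/
theorem sideState_spec (n : ℕ) : ∀ k < 3 * 4 ^ n,
    Tri n (sideState n k).1 ∧ ¬ Tri n ((sideState n k).1.prv (sideState n k).2) := by
  induction n with
  | zero =>
    intro k hk
    exact ⟨rfl, prv_ne _ _⟩
  | succ n ih =>
    intro k hk
    obtain ⟨h1, h2⟩ := ih (k / 4) (by rw [pow_succ] at hk; omega)
    simp only [sideState]
    generalize (sideState n (k / 4)).1 = t at *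
    generalize (sideState n (k / 4)).2 = d at *
    have hv := h1.valid
    have hg : (t.glue d).Valid := by have := sum_glue t d; unfold Valid at *; omega
    have hgT : Tri (n + 1) (t.glue d) :=
      ⟨hg, Or.inr ⟨_, isMid_glue hv d, by rwa [par_prv_glue hv]⟩⟩
    split_ifs with h3 h4 h4 h5 h5
    · refine ⟨⟨by rw [Valid, sum_subFst]; exact hv, Or.inl (by rwa [par_subFst hv])⟩, ?_⟩
      rintro ⟨-, h | ⟨e, he, -⟩⟩
      · rw [par_prv_subFst hv] at h; exact h2 h
      · exact not_isMid_prv_subFst hv d e he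
    all_goals try
      refine ⟨hgT, not_tri_prv_of_isMid hg (isMid_glue hv d) (by rwa [par_glue hv]) ?_⟩
      simp only [baseDir]
      split_ifs
      clear * -
      revert d; decide
    refine ⟨⟨by rw [Valid, sum_subLst]; exact hv, Or.inl (by rwa [par_subLst hv])⟩, ?_⟩
    rintro ⟨-, h | ⟨e, he, -⟩⟩
    · rw [par_prv_subLst hv] at h; exact h2 h
    · exact not_isMid_prv_subLst hv d e he

/-- Every boundary edge of the `n`-th table is a side of the `n`-th polygon. -/
theorem exists_sideState {n : ℕ} : ∀ {t : Tile} {d : Fin 3}, Tri n t → ¬ Tri n (t.prv d) →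
    ∃ k < 3 * 4 ^ n, sideState n k = (t, d) := by
  induction n with
  | zero =>
    rintro t d rfl -
    fin_cases d
    · exact ⟨0, by norm_num, rfl⟩
    · exact ⟨1, by norm_num, rfl⟩
    · exact ⟨2, by norm_num, rfl⟩
  | succ n ih =>
    intro t d ht hd
    have hv := ht.valid
    have child : ∀ k i : ℕ, k < 3 * 4 ^ n → i < 4 → 4 * k + i < 3 * 4 ^ (n + 1) ∧
        (4 * k + i) / 4 = k ∧ (4 * k + i) % 4 = i := by
      intro k i hk hi; rw [pow_succ]; omega
    by_cases hp : Tri n t.par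
    · have h1 : ¬ Tri n (t.prv d).par := fun h => hd ⟨hv.prv d, Or.inl h⟩
      have h2 : (t.prv d).par = t.par.prv d := by
        rcases par_prv hv d with h | h
        · rw [h] at h1; exact absurd hp h1
        · exact h.1
      rw [h2] at h1
      obtain ⟨k, hk, hs⟩ := ih hp h1
      rcases eq_subFst_or_subLst hv h2 with h | h | h
      · obtain ⟨c1, c2, c3⟩ := child k 0 hk (by norm_num)
        refine ⟨_, c1, ?_⟩
        simp only [sideState, c2, c3, hs, if_true, ← h]
      · obtain ⟨c1, c2, c3⟩ := child k 3 hk (by norm_num)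
        refine ⟨_, c1, ?_⟩
        simp [sideState, c2, c3, hs, ← h]
      · exact absurd ⟨hv.prv d, Or.inr ⟨_, h, by rwa [prv_baseDir hv]⟩⟩ hd
    -- Otherwise `t` is a glued cell. The edge in question is not its base, so it is one of the two
    -- new sides, the children with index `1` and `2`.
    · obtain ⟨e, he, hT⟩ := ht.2.resolve_left hp
      have hne : d ≠ e := by
        rintro rfl; exact hd ⟨hv.prv d, Or.inl hT⟩
      have h1 := he.par_prv hv
      rw [h1] at hT
      have hb : (t.par.prv e).prv (t.baseDir e) = t.par := by
        rw [← par_glue hT.valid, ← he.eq_glue hv]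
      obtain ⟨k, hk, hs⟩ := ih hT (by rwa [hb])
      rcases he.eq_of_ne hv hne with h | h
      · obtain ⟨c1, c2, c3⟩ := child k 1 hk (by norm_num)
        refine ⟨_, c1, ?_⟩
        simp [sideState, c2, c3, hs, ← he.eq_glue hv, ← h]
      · obtain ⟨c1, c2, c3⟩ := child k 2 hk (by norm_num)
        refine ⟨_, c1, ?_⟩
        simp [sideState, c2, c3, hs, ← he.eq_glue hv, ← h]

/-! ### Coarser lattices and progress along a direction -/

namespace Tile

/-- The tile of the `3 ^ K` times coarser lattice containing `t`. -/
def anc (K : ℕ) (t : Tile) : Tile := par^[K] t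

theorem anc_succ (K : ℕ) (t : Tile) : anc (K + 1) t = par (anc K t) :=
  Function.iterate_succ_apply' _ _ _

theorem anc_succ' (K : ℕ) (t : Tile) : anc (K + 1) t = anc K (par t) :=
  Function.iterate_succ_apply _ _ _

theorem anc_eq (K : ℕ) (t : Tile) : anc K t = ⟨t.p / 3 ^ K, t.q / 3 ^ K, t.r / 3 ^ K⟩ := by
  induction K with
  | zero => simp [anc]
  | succ K ih =>
    rw [anc_succ, ih, par]
    simp only [pow_succ]
    rw [Int.ediv_ediv_of_nonneg, Int.ediv_ediv_of_nonneg, Int.ediv_ediv_of_nonneg] <;> positivity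

theorem Valid.anc {t : Tile} (h : t.Valid) (K : ℕ) : (t.anc K).Valid := by
  induction K with
  | zero => exact h
  | succ K ih => rw [anc_succ]; exact ih.par

theorem anc_nxt {t : Tile} (h : t.Valid) (d : Fin 3) (K : ℕ) :
    (t.nxt d).anc K = t.anc K ∨
      ((t.nxt d).anc K = (t.anc K).nxt d ∧ t.sum = (t.anc K).sum) := by
  induction K with
  | zero => exact Or.inr ⟨rfl, rfl⟩
  | succ K ih =>
    rw [anc_succ, anc_succ]
    rcases ih with h1 | ⟨h1, h2⟩
    · rw [h1]; exact Or.inl rfl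
    · rw [h1, h2]; exact par_nxt (h.anc K) d

theorem anc_prv {t : Tile} (h : t.Valid) (d : Fin 3) (K : ℕ) :
    (t.prv d).anc K = t.anc K ∨
      ((t.prv d).anc K = (t.anc K).prv d ∧ t.sum = (t.anc K).sum) := by
  induction K with
  | zero => exact Or.inr ⟨rfl, rfl⟩
  | succ K ih =>
    rw [anc_succ, anc_succ]
    rcases ih with h1 | ⟨h1, h2⟩
    · rw [h1]; exact Or.inl rfl
    · rw [h1, h2]; exact par_prv (h.anc K) d

/-- A quantity that increases by one with every tile crossed in direction `d`. -/
def height (t : Tile) (d : Fin 3) : ℤ := t.get (d + 1) - t.get (d + 2)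

theorem height_nxt (t : Tile) (d : Fin 3) : (t.nxt d).height d = t.height d + 1 := by
  fin_cases d <;> simp [height, Tile.nxt, add, get] <;> omega

/-- Together with `height_nxt` this forces straight motion to leave any coarser tile. -/
theorem height_lt {t T : Tile} {K : ℕ} (h : t.anc K = T) (d : Fin 3) :
    t.height d < 3 ^ K * (T.get (d + 1) + 1) - 3 ^ K * T.get (d + 2) := by
  have h3 : (0 : ℤ) < 3 ^ K := by positivity
  have key : ∀ x : ℤ, x < 3 ^ K * (x / 3 ^ K + 1) ∧ 3 ^ K * (x / 3 ^ K) ≤ x := fun x =>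
    ⟨by have := Int.lt_ediv_add_one_mul_self x h3; linarith, Int.mul_ediv_self_le h3.ne'⟩
  rw [anc_eq] at h
  subst h
  have := key t.p; have := key t.q; have := key t.r
  fin_cases d <;> simp [height, get] <;> linarith

theorem turn_eq_of_sum {s t : Tile} (h : s.sum = t.sum) (d : Fin 3) : s.turn d = t.turn d := by
  simp [turn, h]

theorem turn_ne {t : Tile} (d : Fin 3) : t.turn d ≠ d := by
  unfold turn; split_ifs <;> revert d <;> decide

theorem turn_turn_ne {t : Tile} (d : Fin 3) : t.turn (t.turn d) ≠ d := by
  unfold turn; split_ifs <;> revert d <;> decide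

theorem turn_turn_turn {t : Tile} (d : Fin 3) : t.turn (t.turn (t.turn d)) = d := by
  unfold turn; split_ifs <;> revert d <;> decide

/-- The two orientations turn by opposite steps modulo three, and twice a step is the opposite step.
Hence two reflections inside a glued cell act like one reflection in its base from outside. -/
theorem turn_turn_of_sum {s t : Tile} (hs : s.Valid) (h : t.sum = -3 - s.sum) (d : Fin 3) :
    t.turn (t.turn d) = s.turn d := by
  rcases hs with h1 | h1 <;> simp [turn, h1, h] <;> clear * - <;> revert d <;> decide

theorem exists_turn_iterate (t : Tile) (d e : Fin 3) : ∃ j, t.turn (t.turn^[j] d) = e := by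
  have : t.turn d = e ∨ t.turn (t.turn d) = e ∨ t.turn (t.turn (t.turn d)) = e := by
    unfold turn; split_ifs <;> clear * - <;> revert d e <;> decide
  rcases this with h | h | h
  exacts [⟨0, h⟩, ⟨1, h⟩, ⟨2, h⟩]

end Tile

theorem Tri.of_anc {m K : ℕ} {t : Tile} (hv : t.Valid) (h : Tri m (t.anc K)) : Tri (m + K) t := by
  induction K generalizing t with
  | zero => exact h
  | succ K ih => exact ⟨hv, Or.inl (ih hv.par (by rwa [← anc_succ']))⟩

/-! ### The flow on states and its return to the central triangle -/

/-- A state of the billiard in the triangulated table: the tile that is being crossed, the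
direction of motion, and the fractional part of the coordinate that is constant along it. -/
structure State where
  tile : Tile
  d : Fin 3
  v : ℝ

open Classical in
/-- Cross a tile, then either enter the next tile of the table or be reflected. -/
noncomputable def flow (n : ℕ) (s : State) : State :=
  if Tri n (s.tile.nxt s.d) then ⟨s.tile.nxt s.d, s.d, s.v⟩
  else ⟨s.tile, s.tile.turn s.d, 1 - s.v⟩

/-- The flow leads from `s` to `s'` after finitely many tiles. -/
def Reaches (n : ℕ) (s s' : State) : Prop := ∃ i, (flow n)^[i] s = s'

theorem Reaches.refl (n : ℕ) (s : State) : Reaches n s s := ⟨0, rfl⟩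

theorem Reaches.trans {n : ℕ} {s₁ s₂ s₃ : State} (h : Reaches n s₁ s₂) (h' : Reaches n s₂ s₃) :
    Reaches n s₁ s₃ := by
  obtain ⟨i, rfl⟩ := h
  obtain ⟨j, rfl⟩ := h'
  exact ⟨j + i, Function.iterate_add_apply _ _ _ _⟩

theorem flow_of_tri {n : ℕ} {t : Tile} {d : Fin 3} {v : ℝ} (h : Tri n (t.nxt d)) :
    flow n ⟨t, d, v⟩ = ⟨t.nxt d, d, v⟩ := by simp [flow, h]

theorem flow_of_not_tri {n : ℕ} {t : Tile} {d : Fin 3} {v : ℝ} (h : ¬ Tri n (t.nxt d)) :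
    flow n ⟨t, d, v⟩ = ⟨t, t.turn d, 1 - v⟩ := by simp [flow, h]

theorem Reaches.of_tri {n : ℕ} {t : Tile} {d : Fin 3} {v : ℝ} (h : Tri n (t.nxt d)) :
    Reaches n ⟨t, d, v⟩ ⟨t.nxt d, d, v⟩ := ⟨1, flow_of_tri h⟩

/-- Motion inside a coarser tile leads to the side of it at which it is left. -/
theorem exists_exit {m K : ℕ} (t : Tile) (d : Fin 3) (v : ℝ) (hv : t.Valid)
    (hT : Tri m (t.anc K)) :
    ∃ t', t'.Valid ∧ Reaches (m + K) ⟨t, d, v⟩ ⟨t', d, v⟩ ∧ t'.anc K = t.anc K ∧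
      (t'.nxt d).anc K = (t.anc K).nxt d := by
  -- `N` bounds the height still to be gained before the coarse tile must be left.
  obtain ⟨N, hN⟩ : ∃ N : ℕ, 3 ^ K * ((t.anc K).get (d + 1) + 1) - 3 ^ K * (t.anc K).get (d + 2)
      - t.height d ≤ N := ⟨_, Int.self_le_toNat _⟩
  induction N generalizing t with
  | zero => have := height_lt (rfl : t.anc K = _) d; push_cast at hN; omega
  | succ N ih =>
    rcases anc_nxt hv d K with h | h
    · have hT' : Tri m ((t.nxt d).anc K) := by rwa [h]
      obtain ⟨t', h1, h2, h3, h4⟩ := ih (t.nxt d) (hv.nxt d) hT' (by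
        rw [h, height_nxt]; push_cast at hN; omega)
      exact ⟨t', h1, (Reaches.of_tri (Tri.of_anc (hv.nxt d) hT')).trans h2, h3.trans h,
        by rw [h4, h]⟩
    · exact ⟨t, hv, Reaches.refl _ _, rfl, h.1⟩

/-- Motion that leaves a coarser table through one of its sides comes back through this side,
with the direction it would have after a reflection in it. -/
theorem exists_return (n K : ℕ) : ∀ (m : ℕ), m + K = n → ∀ (t : Tile) (d : Fin 3) (v : ℝ),
    t.Valid → Tri m (t.anc K) → ¬ Tri m ((t.anc K).nxt d) →
    ∃ t' v', t'.Valid ∧ Reaches n ⟨t, d, v⟩ ⟨t', (t.anc K).turn d, v'⟩ ∧ t'.anc K = t.anc K ∧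
      (t'.prv ((t.anc K).turn d)).anc K = (t.anc K).nxt d := by
  induction K with
  | zero =>
    rintro m rfl t d v hv - hn
    exact ⟨t, 1 - v, hv, ⟨1, flow_of_not_tri hn⟩, rfl, prv_turn hv d⟩
  | succ K ih =>
    intro m hm t d v hv hT hn
    have hm' : m + 1 + K = n := by omega
    obtain ⟨t₁, hv₁, r₁, a₁, b₁⟩ := exists_exit t d v hv hT
    rw [hm] at r₁
    set T := t.anc (K + 1) with hTdef
    rw [anc_succ] at a₁ b₁
    set T₁ := t₁.anc K with hT₁
    have hv₁' : T₁.Valid := hv₁.anc K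
    have hvT : T.Valid := hT.valid
    have hT₁m : Tri (m + 1) T₁ := ⟨hv₁', Or.inl (by rwa [a₁])⟩
    have c₁ : (t₁.nxt d).anc K = T₁.nxt d := by
      rcases anc_nxt hv₁ d K with h | h
      · rw [h, ← hT₁, a₁] at b₁; exact absurd b₁.symm (nxt_ne T d)
      · exact h.1
    rw [c₁] at b₁
    have hsum : T₁.sum = T.sum := by
      rcases par_nxt hv₁' d with h | h
      · rw [b₁, a₁] at h; exact absurd h (nxt_ne T d)
      · rw [h.2, a₁]
    -- Either the ball enters the cell `C` glued to this side, or it meets an outer third, which is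
    -- a side of the table of level `m + 1`, and the induction hypothesis applies directly.
    by_cases hC : Tri (m + 1) (T₁.nxt d)
    · have hTn : ∀ {s : Tile}, s.Valid → Tri (m + 1) (s.anc K) → Tri n s := fun hs h =>
        hm' ▸ Tri.of_anc hs h
      set C := T₁.nxt d with hCdef
      have hvC := hC.valid
      obtain ⟨e, he, he'⟩ := hC.2.resolve_left (by rwa [b₁])
      -- `C` can only be glued on the edge through which it is entered, since the tile across any
      -- other edge has the same parent as `C`.
      obtain rfl : e = d := by
        by_contra hne
        have h5 : (C.prv d).par = C.par := he.par_prv_of_ne hvC (Ne.symm hne)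
        rw [hCdef, prv_nxt, a₁, ← hCdef, b₁] at h5
        exact nxt_ne T d h5.symm
      have hout : ∀ f, C.turn f ≠ e → ¬ Tri (m + 1) (C.nxt f) := fun f hf => by
        rw [← prv_turn hvC]
        exact not_tri_prv_of_isMid hvC he (by rwa [b₁]) hf
      have r₂ : Reaches n ⟨t₁, e, v⟩ ⟨t₁.nxt e, e, v⟩ :=
        Reaches.of_tri (hTn (hv₁.nxt e) (by rwa [c₁]))
      -- Each free side of `C` sends the ball back into `C`, by induction. The third turn would
      -- restore the direction `e`, so after two turns the ball heads for the base.
      obtain ⟨t₂, v₂, hv₂, r₃, a₂, -⟩ := ih (m + 1) hm' (t₁.nxt e) e v (hv₁.nxt e) (by rwa [c₁])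
        (by rw [c₁]; exact hout _ (turn_ne e))
      rw [c₁] at r₃ a₂
      obtain ⟨t₃, v₃, hv₃, r₄, a₃, -⟩ := ih (m + 1) hm' t₂ (C.turn e) v₂ hv₂ (by rwa [a₂])
        (by rw [a₂]; exact hout _ (turn_turn_ne e))
      rw [a₂] at r₄ a₃
      obtain ⟨t₄, hv₄, r₅, a₄, b₄⟩ := exists_exit t₃ (C.turn (C.turn e)) v₃ hv₃
        (m := m + 1) (K := K) (by rwa [a₃])
      rw [hm'] at r₅
      rw [a₃, ← prv_turn hvC, turn_turn_turn, hCdef, prv_nxt, ← hCdef] at b₄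
      rw [a₃] at a₄
      have hd : C.turn (C.turn e) = T.turn e :=
        turn_turn_of_sum hvT (by rw [hCdef, sum_nxt, hsum]) e
      rw [hd] at r₄ r₅ b₄
      refine ⟨t₄.nxt (T.turn e), v₃, hv₄.nxt _, ?_, ?_, ?_⟩
      · exact r₁.trans <| r₂.trans <| r₃.trans <| r₄.trans <| r₅.trans <|
          Reaches.of_tri (hTn (hv₄.nxt _) (by rwa [b₄]))
      · rw [anc_succ, b₄, a₁]
      · rw [prv_nxt, anc_succ, a₄, b₁]
    · obtain ⟨t', v', hv', r₂, a₂, b₂⟩ := ih (m + 1) hm' t₁ d v hv₁ hT₁m hC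
      rw [turn_eq_of_sum hsum] at r₂ b₂
      refine ⟨t', v', hv', r₁.trans r₂, ?_, ?_⟩
      · rw [anc_succ, a₂, a₁]
      · rw [anc_succ, b₂, b₁]

/-- Every state reaches the central triangle. -/
theorem exists_reaches_root (n m : ℕ) : ∀ (K : ℕ), m + K = n → ∀ (t : Tile) (d : Fin 3) (v : ℝ),
    t.Valid → Tri m (t.anc K) →
    ∃ s, Reaches n ⟨t, d, v⟩ s ∧ s.tile.Valid ∧ s.tile.anc n = ⟨0, 0, -1⟩ := by
  induction m with
  | zero =>
    intro K hK t d v hv hT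
    rw [zero_add] at hK
    subst hK
    exact ⟨_, Reaches.refl _ _, hv, hT⟩
  | succ m ih =>
    intro K hK t d v hv hT
    by_cases hp : Tri m (t.anc K).par
    · exact ih (K + 1) (by omega) t d v hv (by rwa [anc_succ])
    · obtain ⟨e, he, he'⟩ := hT.2.resolve_left hp
      -- The coarse tile is a glued cell with base at direction `e`. After `j` returns from free
      -- sides the direction is one that leaves through the base.
      obtain ⟨j, hj⟩ := exists_turn_iterate (t.anc K) d e
      generalize hC : t.anc K = C at *
      have hvC := hT.valid
      have base : ∀ (t : Tile) (d : Fin 3) (v : ℝ), t.Valid → t.anc K = C → C.turn d = e →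
          ∃ s, Reaches n ⟨t, d, v⟩ s ∧ s.tile.Valid ∧ s.tile.anc n = ⟨0, 0, -1⟩ := by
        intro t d v hv hC hde
        obtain ⟨t₁, hv₁, r₁, -, b₁⟩ := exists_exit t d v hv (m := m + 1) (K := K) (by rwa [hC])
        rw [hC, ← prv_turn hvC, hde] at b₁
        rw [hK] at r₁
        have h1 : Tri m ((t₁.nxt d).anc (K + 1)) := by rw [anc_succ, b₁]; exact he'
        obtain ⟨s, r₂, hs⟩ := ih (K + 1) (by omega) (t₁.nxt d) d v (hv₁.nxt d) h1
        have h2 : Tri n (t₁.nxt d) := by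
          have := Tri.of_anc (hv₁.nxt d) h1
          rwa [show m + (K + 1) = n by omega] at this
        exact ⟨s, r₁.trans ((Reaches.of_tri h2).trans r₂), hs⟩
      induction j generalizing t d v with
      | zero => exact base t d v hv hC hj
      | succ j ihj =>
        by_cases hde : C.turn d = e
        · exact base t d v hv hC hde
        · obtain ⟨t', v', hv', r₁, a₁, -⟩ := exists_return n K (m + 1) hK t d v hv (by rwa [hC])
            (by rw [hC, ← prv_turn hvC]; exact not_tri_prv_of_isMid hvC he hp hde)
          rw [hC] at r₁ a₁
          obtain ⟨s, r₂, hs⟩ := ihj t' (C.turn d) v' hv' a₁ hj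
          exact ⟨s, r₁.trans r₂, hs⟩

/-- Every state reaches a state that crosses the base `I` of the central triangle in the direction
with index `0`. -/
theorem exists_reaches_base {n : ℕ} {t : Tile} (d : Fin 3) (v : ℝ) (h : Tri n t) :
    ∃ (p : ℤ) (v' : ℝ), 0 ≤ p ∧ p < 3 ^ n ∧ Reaches n ⟨t, d, v⟩ ⟨⟨p, 0, -1 - p⟩, 0, v'⟩ := by
  obtain ⟨⟨t₁, d₁, v₁⟩, r₁, hv₁, a₁⟩ := exists_reaches_root n n 0 (by simp) t d v h.valid h
  dsimp only at hv₁ a₁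
  have key : ∀ (t₁ : Tile) d₁ v₁, t₁.Valid → t₁.anc n = ⟨0, 0, -1⟩ →
      ∃ t' v', t'.Valid ∧ Reaches n ⟨t₁, d₁, v₁⟩ ⟨t', d₁ + 1, v'⟩ ∧ t'.anc n = ⟨0, 0, -1⟩ ∧
      (t'.prv (d₁ + 1)).anc n = (⟨0, 0, -1⟩ : Tile).prv (d₁ + 1) := by
    intro t₁ d₁ v₁ hv₁ a₁
    have hv0 : (⟨0, 0, -1⟩ : Tile).Valid := Or.inl rfl
    obtain ⟨t', v', h1, h2, h3, h4⟩ := exists_return n n 0 (by simp) t₁ d₁ v₁ hv₁ a₁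
      (by rw [a₁]; exact nxt_ne _ _)
    rw [a₁] at h2 h3 h4
    rw [← prv_turn hv0] at h4
    exact ⟨t', v', h1, h2, h3, h4⟩
  -- Each return to the root adds one to the direction index. At least one return is needed, even
  -- for `d₁ = 0`, so that the ball has just entered through the base.
  obtain ⟨t', v', hv', r', a', b'⟩ : ∃ t' v', t'.Valid ∧ Reaches n ⟨t₁, d₁, v₁⟩ ⟨t', 0, v'⟩ ∧
      t'.anc n = ⟨0, 0, -1⟩ ∧ (t'.prv 0).anc n = (⟨0, 0, -1⟩ : Tile).prv 0 := by
    obtain ⟨t₂, v₂, hv₂, r₂, a₂, b₂⟩ := key t₁ d₁ v₁ hv₁ a₁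
    obtain ⟨t₃, v₃, hv₃, r₃, a₃, b₃⟩ := key t₂ (d₁ + 1) v₂ hv₂ a₂
    obtain ⟨t₄, v₄, hv₄, r₄, a₄, b₄⟩ := key t₃ (d₁ + 1 + 1) v₃ hv₃ a₃
    fin_cases d₁
    · exact ⟨t₄, v₄, hv₄, r₂.trans (r₃.trans r₄), a₄, b₄⟩
    · exact ⟨t₃, v₃, hv₃, r₂.trans r₃, a₃, b₃⟩
    · exact ⟨t₂, v₂, hv₂, r₂, a₂, b₂⟩
  have hs : t'.sum = -1 := by
    rcases anc_prv hv' 0 n with h | h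
    · rw [a', b'] at h; exact absurd h (prv_ne _ _)
    · rw [h.2, a']; rfl
  obtain ⟨p, q, r⟩ := t'
  rw [anc_eq] at a' b'
  have h3 : (0 : ℤ) < 3 ^ n := by positivity
  simp only [Tile.prv, hs, add, Tile.mk.injEq] at a' b'
  obtain ⟨hp, hq, -⟩ := a'
  obtain ⟨-, hq', -⟩ := b'
  simp only [sum] at hs
  have h4 := (Int.ediv_eq_iff_of_pos h3).1 hp
  have h5 := (Int.ediv_eq_iff_of_pos h3).1 hq
  have h6 := (Int.ediv_eq_iff_of_pos h3).1 hq'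
  -- The tile behind has second coordinate `q - 1` and lies below the root, so `0 ≤ q` and `q - 1 <
  -- 0`.
  obtain rfl : q = 0 := by
    rw [show (0 : ℤ) + (-2 - (⟨0, 0, -1⟩ : Tile).sum) = -1 from rfl] at h6; omega
  obtain rfl : r = -1 - p := by omega
  exact ⟨p, v', by omega, by omega, r₁.trans r'⟩

/-! ### Finiteness and periodicity -/

theorem Tri.bounded (n : ℕ) : ∃ B : ℤ, ∀ t, Tri n t → (-B ≤ t.p ∧ t.p ≤ B) ∧
    (-B ≤ t.q ∧ t.q ≤ B) ∧ (-B ≤ t.r ∧ t.r ≤ B) := by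
  induction n with
  | zero => exact ⟨1, by rintro t rfl; simp⟩
  | succ n ih =>
    obtain ⟨B, hB⟩ := ih
    refine ⟨3 * B + 4, ?_⟩
    rintro t ⟨hv, h | ⟨d, -, h⟩⟩
    · have := hB _ h
      simp only [Tile.par] at this
      omega
    · have := hB _ h
      rcases hv with hv | hv <;> fin_cases d <;> simp [Tile.par, Tile.prv, add, hv] at this <;> omega

theorem Tri.finite (n : ℕ) : {t | Tri n t}.Finite := by
  obtain ⟨B, hB⟩ := Tri.bounded n
  have : (Set.Icc (-B) B ×ˢ Set.Icc (-B) B ×ˢ Set.Icc (-B) B).Finite :=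
    (Set.finite_Icc _ _).prod ((Set.finite_Icc _ _).prod (Set.finite_Icc _ _))
  refine (this.image fun x => (⟨x.1, x.2.1, x.2.2⟩ : Tile)).subset fun t ht => ?_
  exact ⟨(t.p, t.q, t.r), ⟨(hB t ht).1, (hB t ht).2.1, (hB t ht).2.2⟩, rfl⟩

theorem flow_tri {n : ℕ} {s : State} (h : Tri n s.tile) : Tri n (flow n s).tile := by
  unfold flow; split_ifs with h1 <;> assumption

theorem flow_iterate_tri {n : ℕ} {s : State} (h : Tri n s.tile) (i : ℕ) :
    Tri n ((flow n)^[i] s).tile := by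
  induction i with
  | zero => exact h
  | succ i ih => rw [Function.iterate_succ_apply']; exact flow_tri ih

theorem flow_v (n : ℕ) (s : State) {u : ℝ} (h : s.v = u ∨ s.v = 1 - u) :
    (flow n s).v = u ∨ (flow n s).v = 1 - u := by
  unfold flow; split_ifs with h1
  · exact h
  · rcases h with h | h <;> simp [h]

theorem flow_iterate_v (n : ℕ) (s : State) (i : ℕ) :
    ((flow n)^[i] s).v = s.v ∨ ((flow n)^[i] s).v = 1 - s.v := by
  induction i with
  | zero => exact Or.inl rfl
  | succ i ih => rw [Function.iterate_succ_apply']; exact flow_v n _ ih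

/-- The last move can be read off from its result: after a crossing the tile behind belongs to the
table, after a reflection it does not. -/
theorem flow_injOn (n : ℕ) : Set.InjOn (flow n) {s | Tri n s.tile} := by
  have key : ∀ s s' : State, Tri n s.tile → Tri n s'.tile → Tri n (s.tile.nxt s.d) →
      ¬ Tri n (s'.tile.nxt s'.d) → flow n s ≠ flow n s' := by
    rintro ⟨t, d, v⟩ ⟨t', d', v'⟩ h h' h1 h2 he
    rw [flow_of_tri h1, flow_of_not_tri h2, State.mk.injEq] at he
    dsimp only at h h' h1 h2 he
    rw [← prv_turn h'.valid, ← he.2.1, ← he.1, prv_nxt] at h2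
    exact h2 h
  rintro ⟨t, d, v⟩ h ⟨t', d', v'⟩ h' he
  by_cases h1 : Tri n (t.nxt d) <;> by_cases h2 : Tri n (t'.nxt d')
  · rw [flow_of_tri h1, flow_of_tri h2, State.mk.injEq] at he
    obtain ⟨h3, rfl, rfl⟩ := he
    rw [← prv_nxt t d, h3, prv_nxt]
  · exact absurd he (key _ _ h h' h1 h2)
  · exact absurd he.symm (key _ _ h' h h2 h1)
  · rw [flow_of_not_tri h1, flow_of_not_tri h2, State.mk.injEq] at he
    obtain ⟨rfl, h3, h4⟩ := he
    rw [turn_injective _ h3, sub_right_injective h4]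

/-- Every state is periodic. -/
theorem exists_period {n : ℕ} {s : State} (h : Tri n s.tile) :
    ∃ P, 0 < P ∧ (flow n)^[P] s = s := by
  have hfin : {s' : State | Tri n s'.tile ∧ (s'.v = s.v ∨ s'.v = 1 - s.v)}.Finite := by
    have h1 : ({s.v, 1 - s.v} : Set ℝ).Finite := by simp
    refine (((Tri.finite n).prod (Set.finite_univ (α := Fin 3) |>.prod h1)).image
      fun x => (⟨x.1, x.2.1, x.2.2⟩ : State)).subset ?_
    rintro ⟨t, d, v⟩ ⟨h2, h3⟩
    exact ⟨(t, d, v), ⟨h2, Set.mem_univ _, h3⟩, rfl⟩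
  obtain ⟨i, j, hij, he⟩ := Set.Finite.exists_lt_map_eq_of_forall_mem
    (t := {s' : State | Tri n s'.tile ∧ (s'.v = s.v ∨ s'.v = 1 - s.v)})
    (f := fun i : ℕ => (flow n)^[i] s)
    (fun i => ⟨flow_iterate_tri h i, flow_iterate_v n s i⟩) hfin
  refine ⟨j - i, by omega, ?_⟩
  -- Injectivity cancels the common initial steps, so the repetition starts at `s` itself.
  have key : ∀ k l, (flow n)^[k] s = (flow n)^[l + k] s → s = (flow n)^[l] s := by
    intro k l hk
    induction k with
    | zero => exact hk
    | succ k ih =>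
      rw [← add_assoc, Function.iterate_succ_apply', Function.iterate_succ_apply'] at hk
      exact ih (flow_injOn n (flow_iterate_tri h _) (flow_iterate_tri h _) hk)
  exact (key i (j - i) (by rw [Nat.sub_add_cancel hij.le]; exact he)).symm

/-- Following `P` steps at a time returns to `s`; stopping the journey from `s'` at a multiple of
the period reaches `s`. -/
theorem Reaches.symm {n : ℕ} {s s' : State} (h : Tri n s.tile) (hr : Reaches n s s') :
    Reaches n s' s := by
  obtain ⟨i, rfl⟩ := hr
  obtain ⟨P, hP, hp⟩ := exists_period h
  refine ⟨P * i - i, ?_⟩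
  rw [← Function.iterate_add_apply, Nat.sub_add_cancel (Nat.le_mul_of_pos_left i hP),
    Function.iterate_mul]
  exact Function.iterate_fixed hp i

/-! ### Straight motion from the boundary -/

/-- States entering the table through one of its sides. -/
def Bdry (n : ℕ) (s : State) : Prop := Tri n s.tile ∧ ¬ Tri n (s.tile.prv s.d)

/-- The flow leads from `b` to `s` without reflections. -/
inductive Straight (n : ℕ) (b : State) : State → Prop
  | refl : Straight n b b
  | step {s : State} : Straight n b s → Tri n (s.tile.nxt s.d) →
      Straight n b ⟨s.tile.nxt s.d, s.d, s.v⟩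

theorem Straight.reaches {n : ℕ} {b s : State} (h : Straight n b s) : Reaches n b s := by
  induction h with
  | refl => exact Reaches.refl _ _
  | step _ h2 ih => exact ih.trans (Reaches.of_tri h2)

theorem Straight.tri {n : ℕ} {b s : State} (h : Straight n b s) (hb : Tri n b.tile) :
    Tri n s.tile := by
  cases h with
  | refl => exact hb
  | step _ h2 => exact h2

theorem Straight.d_eq {n : ℕ} {b s : State} (h : Straight n b s) : s.d = b.d := by
  induction h with
  | refl => rfl
  | step _ _ ih => exact ih

theorem Straight.v_eq {n : ℕ} {b s : State} (h : Straight n b s) : s.v = b.v := by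
  induction h with
  | refl => rfl
  | step _ _ ih => exact ih

theorem Straight.eq_of_bdry {n : ℕ} {b s : State} (h : Straight n b s) (hb : Tri n b.tile)
    (hs : Bdry n s) : s = b := by
  cases h with
  | refl => rfl
  | step h1 h2 => exact absurd (by rw [prv_nxt]; exact h1.tri hb) hs.2

/-- Going back from a state one arrives at a side. -/
theorem exists_straight {n : ℕ} (s : State) (h : Tri n s.tile) :
    ∃ b, Bdry n b ∧ Straight n b s := by
  obtain ⟨B, hB⟩ := Tri.bounded n
  have hlow : ∀ t d, Tri n t → 0 ≤ t.height d + 2 * B := by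
    intro t d ht
    have := hB t ht
    fin_cases d <;> simp [height, Tile.get] <;> omega
  obtain ⟨N, hN⟩ : ∃ N : ℕ, s.tile.height s.d + 2 * B ≤ N := ⟨_, Int.self_le_toNat _⟩
  induction N generalizing s with
  | zero =>
    by_cases hp : Tri n (s.tile.prv s.d)
    · have h1 := hlow _ s.d hp
      have h2 := height_nxt (s.tile.prv s.d) s.d
      rw [nxt_prv] at h2
      push_cast at hN
      omega
    · exact ⟨s, ⟨h, hp⟩, Straight.refl⟩
  | succ N ih =>
    by_cases hp : Tri n (s.tile.prv s.d)
    · have h2 := height_nxt (s.tile.prv s.d) s.d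
      rw [nxt_prv] at h2
      obtain ⟨b, hb, hs⟩ := ih ⟨s.tile.prv s.d, s.d, s.v⟩ hp (by push_cast at hN; dsimp; omega)
      have := hs.step (by rw [nxt_prv]; exact h)
      rw [nxt_prv] at this
      exact ⟨b, hb, this⟩
    · exact ⟨s, ⟨h, hp⟩, Straight.refl⟩

/-! ### The six directions and the lattice coordinates in the plane -/

theorem dir_add (i j : ℤ) : dir (i + j) = dir i * dir j := by
  unfold dir
  rw [← Complex.exp_add]
  push_cast
  ring_nf

theorem dir_zero : dir 0 = 1 := by simp [dir]

theorem dir_three : dir 3 = -1 := by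
  unfold dir
  rw [← Complex.exp_pi_mul_I]
  push_cast
  ring_nf

theorem dir_ne_zero (j : ℤ) : dir j ≠ 0 := Complex.exp_ne_zero _

theorem dir_six_mul (j : ℤ) : dir (6 * j) = 1 := by
  unfold dir
  rw [Complex.exp_eq_one_iff]
  exact ⟨j, by push_cast; ring⟩

theorem dir_eq_of_dvd {i j : ℤ} (h : (6 : ℤ) ∣ i - j) : dir i = dir j := by
  obtain ⟨k, hk⟩ := h
  rw [show i = j + 6 * k by omega, dir_add, dir_six_mul, mul_one]

theorem dir_one : dir 1 = ⟨1 / 2, √3 / 2⟩ := by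
  unfold dir
  rw [show (((1 : ℤ) : ℂ) * (Real.pi : ℂ) / 3) = ((Real.pi / 3 : ℝ) : ℂ) by push_cast; ring]
  apply Complex.ext
  · rw [Complex.exp_ofReal_mul_I_re, Real.cos_pi_div_three]
  · rw [Complex.exp_ofReal_mul_I_im, Real.sin_pi_div_three]

theorem dir_one_sq : dir 1 * dir 1 = dir 1 - 1 := by
  have h3 : √3 * √3 = 3 := Real.mul_self_sqrt (by norm_num)
  rw [dir_one]
  apply Complex.ext
  · simp only [Complex.mul_re, Complex.sub_re, Complex.one_re]; linarith
  · simp only [Complex.mul_im, Complex.sub_im, Complex.one_im]; linarith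

theorem dir_two : dir 2 = dir 1 - 1 := by
  rw [show (2 : ℤ) = 1 + 1 by norm_num, dir_add, dir_one_sq]

theorem dir_four : dir 4 = - dir 1 := by
  rw [show (4 : ℤ) = 3 + 1 by norm_num, dir_add, dir_three]; ring

theorem dir_five : dir 5 = 1 - dir 1 := by
  rw [show (5 : ℤ) = 3 + 2 by norm_num, dir_add, dir_three, dir_two]; ring

theorem dir_neg_one : dir (-1) = 1 - dir 1 := by
  rw [← dir_five]; exact dir_eq_of_dvd (by norm_num)

theorem conj_dir (j : ℤ) : (starRingEnd ℂ) (dir j) = dir (-j) := by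
  unfold dir
  rw [← Complex.exp_conj, map_mul, map_div₀, map_mul, Complex.conj_ofReal, Complex.conj_I,
    map_ofNat, map_intCast]
  push_cast
  ring_nf

theorem reflect_dir (m j : ℤ) {c : ℝ} (hc : c ≠ 0) :
    reflect (dir m * c) (dir j) = dir (2 * m - j) := by
  have h1 : (c : ℂ) ≠ 0 := by exact_mod_cast hc
  have h2 : dir (-m) * dir m = 1 := by rw [← dir_add]; simp [dir_zero]
  unfold reflect
  rw [map_mul, conj_dir, conj_dir, Complex.conj_ofReal, mul_div_mul_right _ _ h1,
    div_mul_eq_mul_div, div_eq_iff (dir_ne_zero _), sub_eq_add_neg, dir_add, two_mul, dir_add]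
  linear_combination (- dir m * dir (-j)) * h2

/-- The point with coordinates `a, b` in the triangular lattice of mesh `3 ^ (-n)`. -/
noncomputable def pos (n : ℕ) (a b : ℝ) : ℂ := (a + b * dir 1) / 3 ^ n

theorem pos_inj {n : ℕ} {a b a' b' : ℝ} (h : pos n a b = pos n a' b') : a = a' ∧ b = b' := by
  have h3 : (3 : ℂ) ^ n ≠ 0 := pow_ne_zero _ (by norm_num)
  have h4 : (a : ℂ) + b * dir 1 = a' + b' * dir 1 := by
    unfold pos at h
    rwa [div_left_inj' h3] at h
  have h5 : 0 < √(3 : ℝ) := by positivity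
  rw [dir_one] at h4
  have him := congrArg Complex.im h4
  have hre := congrArg Complex.re h4
  simp at him hre
  refine ⟨?_, him⟩
  rw [him] at hre
  linarith

theorem pos_succ (n : ℕ) (a b : ℝ) : pos (n + 1) a b = pos n (a / 3) (b / 3) := by
  unfold pos
  push_cast
  field_simp
  ring

/-- The direction of the plane with index `d`. -/
noncomputable def D (d : Fin 3) : ℂ := dir (2 * (d : ℕ) + 1)

theorem D_zero : D 0 = dir 1 := by simp [D]

theorem D_one : D 1 = -1 := by simp [D, dir_three]

theorem D_two : D 2 = 1 - dir 1 := by simp [D, dir_five]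

/-- The direction of the side through which direction `d` enters `t`. -/
def edgeDir (t : Tile) (d : Fin 3) : ℤ := 2 * (d : ℕ) + t.sum + 1

/-- First lattice coordinate of the point where `s` enters its tile. -/
noncomputable def entA (s : State) : ℝ :=
  s.tile.p + match s.d with
  | 0 => s.v
  | 1 => 1 - s.v + (-1 - (s.tile.sum : ℝ)) * s.v
  | 2 => (-1 - (s.tile.sum : ℝ)) * (1 - s.v)

/-- Second lattice coordinate of the point where `s` enters its tile. -/
noncomputable def entB (s : State) : ℝ :=
  s.tile.q + match s.d with
  | 0 => (-1 - (s.tile.sum : ℝ)) * (1 - s.v)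
  | 1 => s.v
  | 2 => 1 - s.v + (-1 - (s.tile.sum : ℝ)) * s.v

/-- The point where `s` enters its tile. -/
noncomputable def ent (n : ℕ) (s : State) : ℂ := pos n (entA s) (entB s)

/-- The distance travelled by `s` in its tile, in units of the mesh. -/
noncomputable def len (s : State) : ℝ := 1 - s.v + (-1 - (s.tile.sum : ℝ)) * (2 * s.v - 1)

theorem ent_nxt {n : ℕ} {t : Tile} (h : t.Valid) (d : Fin 3) (v : ℝ) :
    ent n ⟨t.nxt d, d, v⟩ = ent n ⟨t, d, v⟩ + ((len ⟨t, d, v⟩ / 3 ^ n : ℝ) : ℂ) * D d := by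
  have h1 := sum_nxt t d
  rcases h with h | h <;> rw [h] at h1 <;> norm_num at h1 <;> fin_cases d <;> dsimp at h1 <;>
    simp [ent, pos, entA, entB, len, h, D_zero, D_one, D_two, h1] <;>
    simp [Tile.nxt, add, h] <;> ring

theorem ent_turn {n : ℕ} {t : Tile} (h : t.Valid) (d : Fin 3) (v : ℝ) :
    ent n ⟨t, t.turn d, 1 - v⟩ = ent n ⟨t, d, v⟩ + ((len ⟨t, d, v⟩ / 3 ^ n : ℝ) : ℂ) * D d := by
  rcases h with h | h <;> fin_cases d <;>
    simp [ent, pos, entA, entB, len, turn, h, D_zero, D_one, D_two] <;>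
    ring

theorem len_pos {s : State} (h : s.tile.Valid) (h0 : 0 < s.v) (h1 : s.v < 1) : 0 < len s := by
  rcases h with h | h <;> simp [len, h] <;> linarith

/-- Passing to the other orientation of an edge. -/
theorem ent_prv_baseDir {n : ℕ} {t : Tile} (h : t.Valid) (d : Fin 3) (v : ℝ) :
    ent n ⟨t.prv d, t.baseDir d, 1 - v⟩ = ent n ⟨t, d, v⟩ := by
  have h1 := sum_prv t d
  rcases h with h | h <;> rw [h] at h1 <;> norm_num at h1 <;> fin_cases d <;> dsimp at h1 <;>
    simp [ent, pos, entA, entB, h, baseDir, h1] <;>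
    simp [Tile.prv, add, h, -mul_eq_mul_right_iff] <;> ring

theorem ent_eq_add {n : ℕ} {t : Tile} (h : t.Valid) (d : Fin 3) (v : ℝ) :
    ent n ⟨t, d, v⟩ = ent n ⟨t, d, 0⟩ + v * (dir (edgeDir t d) / 3 ^ n) := by
  rcases h with h | h <;> fin_cases d <;> simp [edgeDir, h] <;>
    simp [ent, pos, entA, entB, h, dir_zero, dir_two, dir_four, dir_neg_one, dir_three] <;> ring

theorem ent_one {n : ℕ} {t : Tile} (h : t.Valid) (d : Fin 3) :
    ent n ⟨t, d, 1⟩ = ent n ⟨t, d + 1, 0⟩ := by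
  rcases h with h | h <;> fin_cases d <;> simp [ent, pos, entA, entB, h]

theorem ent_subFst {n : ℕ} {t : Tile} (h : t.Valid) (d : Fin 3) :
    ent (n + 1) ⟨t.subFst d, d, 0⟩ = ent n ⟨t, d, 0⟩ := by
  have h1 := sum_subFst t d
  rcases h with h | h <;> rw [h] at h1 <;> fin_cases d <;> dsimp at h1 <;>
    simp only [ent, pos_succ] <;> congr 1 <;>
    simp [entA, entB, h, h1] <;>
    simp [subFst, scale, add, h] <;> ring

theorem ent_subLst {n : ℕ} {t : Tile} (h : t.Valid) (d : Fin 3) :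
    ent (n + 1) ⟨t.subLst d, d, 0⟩ = ent n ⟨t, d, 2 / 3⟩ := by
  have h1 := sum_subLst t d
  rcases h with h | h <;> rw [h] at h1 <;> fin_cases d <;> dsimp at h1 <;>
    simp only [ent, pos_succ] <;> congr 1 <;>
    simp [entA, entB, h, h1] <;>
    simp [subLst, scale, add, h] <;> ring

theorem ent_glue {n : ℕ} {t : Tile} (h : t.Valid) (d : Fin 3) :
    ent (n + 1) ⟨t.glue d, if t.sum = -1 then d else d + 2, 0⟩ = ent n ⟨t, d, 1 / 3⟩ := by
  have h1 := sum_glue t d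
  rcases h with h | h <;> rw [h] at h1 <;> norm_num at h1 <;> fin_cases d <;> dsimp at h1 <;>
    simp only [ent, pos_succ] <;> congr 1 <;>
    simp [entA, entB, h, h1] <;>
    simp [glue, scale, add, h] <;> ring

theorem dir_edgeDir_subFst (t : Tile) (d : Fin 3) :
    dir (edgeDir (t.subFst d) d) = dir (edgeDir t d) := by
  rw [edgeDir, edgeDir, sum_subFst]

theorem dir_edgeDir_subLst (t : Tile) (d : Fin 3) :
    dir (edgeDir (t.subLst d) d) = dir (edgeDir t d) := by
  rw [edgeDir, edgeDir, sum_subLst]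

theorem dir_edgeDir_glue {t : Tile} (h : t.Valid) (d : Fin 3) :
    dir (edgeDir (t.glue d) (if t.sum = -1 then d else d + 2)) =
      dir (-1) * dir (edgeDir t d) := by
  rw [← dir_add, edgeDir, edgeDir, sum_glue]
  apply dir_eq_of_dvd
  rcases h with h | h <;> rw [h] <;> fin_cases d <;> decide

theorem dir_edgeDir_glue' {t : Tile} (h : t.Valid) (d : Fin 3) :
    dir (edgeDir (t.glue d) (if t.sum = -1 then d + 1 else d)) =
      dir 1 * dir (edgeDir t d) := by
  rw [← dir_add, edgeDir, edgeDir, sum_glue]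
  apply dir_eq_of_dvd
  rcases h with h | h <;> rw [h] <;> fin_cases d <;> decide

theorem ent_glue' {n : ℕ} {t : Tile} (h : t.Valid) (d : Fin 3) :
    ent (n + 1) ⟨t.glue d, if t.sum = -1 then d + 1 else d, 0⟩ =
      ent n ⟨t, d, 1 / 3⟩ + dir (-1) * dir (edgeDir t d) / 3 ^ (n + 1) := by
  have hg : (t.glue d).Valid := by have := sum_glue t d; unfold Valid at *; omega
  have h1 := ent_eq_add (n := n + 1) hg (if t.sum = -1 then d else d + 2) 1
  rw [ent_one hg, ent_glue h, dir_edgeDir_glue h] at h1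
  rw [← one_mul (dir (-1) * _ / _), ← Complex.ofReal_one, ← h1]
  congr 2
  split_ifs <;> clear * - <;> revert d <;> decide

/-! ### Vertices and sides in lattice coordinates -/

theorem vertex_child (n k : ℕ) :
    vertex (n + 1) (4 * k) = vertex n k ∧
    vertex (n + 1) (4 * k + 1) = vertex n k + sideVec n k / 3 ∧
    vertex (n + 1) (4 * k + 2) = vertex n k + sideVec n k / 3 + dir (-1) * (sideVec n k / 3) ∧
    vertex (n + 1) (4 * k + 3) = vertex n k + 2 * (sideVec n k / 3) ∧
    vertex (n + 1) (4 * k + 4) = vertex n (k + 1) := by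
  have h : ∀ i < 4, (4 * k + i) / 4 = k ∧ (4 * k + i) % 4 = i := by intro i hi; omega
  have h4 : (4 * k + 4) / 4 = k + 1 ∧ (4 * k + 4) % 4 = 0 := by omega
  refine ⟨?_, ?_, ?_, ?_, ?_⟩
  · simp [vertex]
  · simp [vertex, h 1 (by norm_num), sideVec]
  · simp [vertex, h 2 (by norm_num), sideVec]
  · simp [vertex, h 3 (by norm_num), sideVec]
  · simp [vertex, h4]

theorem sideVec_child (n k : ℕ) :
    sideVec (n + 1) (4 * k) = sideVec n k / 3 ∧
    sideVec (n + 1) (4 * k + 1) = dir (-1) * sideVec n k / 3 ∧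
    sideVec (n + 1) (4 * k + 2) = dir 1 * sideVec n k / 3 ∧
    sideVec (n + 1) (4 * k + 3) = sideVec n k / 3 := by
  obtain ⟨h0, h1, h2, h3, h4⟩ := vertex_child n k
  have h5 : vertex n (k + 1) = vertex n k + sideVec n k := by simp [sideVec]
  refine ⟨?_, ?_, ?_, ?_⟩
  · rw [sideVec, h0, h1]; ring
  · rw [sideVec, h1, h2]; ring
  · rw [sideVec, h2, h3, dir_neg_one]; ring
  · rw [sideVec, h3, h4, h5]; ring

theorem sideState_child (n k : ℕ) : sideState (n + 1) (4 * k) =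
      ((sideState n k).1.subFst (sideState n k).2, (sideState n k).2) ∧
    sideState (n + 1) (4 * k + 1) = ((sideState n k).1.glue (sideState n k).2,
      if (sideState n k).1.sum = -1 then (sideState n k).2 else (sideState n k).2 + 2) ∧
    sideState (n + 1) (4 * k + 2) = ((sideState n k).1.glue (sideState n k).2,
      if (sideState n k).1.sum = -1 then (sideState n k).2 + 1 else (sideState n k).2) ∧
    sideState (n + 1) (4 * k + 3) =
      ((sideState n k).1.subLst (sideState n k).2, (sideState n k).2) := by
  have h : ∀ i < 4, (4 * k + i) / 4 = k ∧ (4 * k + i) % 4 = i := by intro i hi; omega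
  refine ⟨?_, ?_, ?_, ?_⟩
  · simp [sideState]
  · simp [sideState, h 1 (by norm_num)]
  · simp [sideState, h 2 (by norm_num)]
  · simp [sideState, h 3 (by norm_num)]

theorem exists_child (k : ℕ) : ∃ l, k = 4 * l ∨ k = 4 * l + 1 ∨ k = 4 * l + 2 ∨ k = 4 * l + 3 :=
  ⟨k / 4, by omega⟩

theorem sideState_valid (n k : ℕ) : (sideState n k).1.Valid := by
  induction n generalizing k with
  | zero => exact Or.inl rfl
  | succ n ih =>
    obtain ⟨l, hl⟩ := exists_child k
    obtain ⟨h0, h1, h2, h3⟩ := sideState_child n l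
    have := ih l
    have := sum_glue (sideState n l).1 (sideState n l).2
    have := sum_subFst (sideState n l).1 (sideState n l).2
    have := sum_subLst (sideState n l).1 (sideState n l).2
    unfold Valid at *
    rcases hl with rfl | rfl | rfl | rfl
    · rw [h0]; dsimp only; omega
    · rw [h1]; dsimp only; omega
    · rw [h2]; dsimp only; omega
    · rw [h3]; dsimp only; omega

theorem vertex_sideVec_eq (n k : ℕ) :
    vertex n k = ent n ⟨(sideState n k).1, (sideState n k).2, 0⟩ ∧
    sideVec n k = dir (edgeDir (sideState n k).1 (sideState n k).2) / 3 ^ n := by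
  induction n generalizing k with
  | zero =>
    have h : k % 3 = 0 ∧ (k + 1) % 3 = 1 ∨ k % 3 = 1 ∧ (k + 1) % 3 = 2 ∨
      k % 3 = 2 ∧ (k + 1) % 3 = 0 := by omega
    rcases h with ⟨h, h'⟩ | ⟨h, h'⟩ | ⟨h, h'⟩ <;>
      simp [vertex, sideVec, sideState, h, h', ent, pos, entA, entB, edgeDir, Tile.sum, dir_zero,
        dir_two, dir_four]
  | succ n ih =>
    obtain ⟨l, hl⟩ := exists_child k
    obtain ⟨h0, h1, h2, h3⟩ := sideState_child n l
    obtain ⟨v0, v1, v2, v3, -⟩ := vertex_child n l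
    obtain ⟨s0, s1, s2, s3⟩ := sideVec_child n l
    obtain ⟨e1, e2⟩ := ih l
    have hv := sideState_valid n l
    generalize sideState n l = S at *
    obtain ⟨t, d⟩ := S
    dsimp only at *
    have e3 := ent_eq_add (n := n) hv d (1 / 3)
    have e4 := ent_eq_add (n := n) hv d (2 / 3)
    rcases hl with rfl | rfl | rfl | rfl
    · rw [h0]; dsimp only
      rw [v0, s0, ent_subFst hv, dir_edgeDir_subFst, e2, pow_succ, div_div]
      exact ⟨e1, rfl⟩
    · rw [h1]; dsimp only
      rw [v1, s1, ent_glue hv, dir_edgeDir_glue hv, e3, e2, e1, pow_succ]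
      exact ⟨by push_cast; ring, by ring⟩
    · rw [h2]; dsimp only
      rw [v2, s2, ent_glue' hv, dir_edgeDir_glue' hv, e3, e2, e1, pow_succ]
      exact ⟨by push_cast; ring, by ring⟩
    · rw [h3]; dsimp only
      rw [v3, s3, ent_subLst hv, dir_edgeDir_subLst, e4, e2, e1, pow_succ]
      exact ⟨by push_cast; ring, by ring⟩

theorem vertex_add_sideVec (n k : ℕ) (w : ℝ) :
    vertex n k + w * sideVec n k = ent n ⟨(sideState n k).1, (sideState n k).2, w⟩ := by
  rw [ent_eq_add (sideState_valid n k), (vertex_sideVec_eq n k).1, (vertex_sideVec_eq n k).2]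

theorem mem_side_iff {n k : ℕ} {z : ℂ} : z ∈ side n k ↔
    ∃ w : ℝ, 0 ≤ w ∧ w ≤ 1 ∧ z = ent n ⟨(sideState n k).1, (sideState n k).2, w⟩ := by
  rw [side, segment_eq_image']
  simp only [Set.mem_image, Set.mem_Icc, Complex.real_smul, ← vertex_add_sideVec, sideVec]
  exact ⟨fun ⟨w, hw, h⟩ => ⟨w, hw.1, hw.2, h.symm⟩, fun ⟨w, h1, h2, h⟩ => ⟨w, ⟨h1, h2⟩, h.symm⟩⟩

theorem mem_openSide_iff {n k : ℕ} {z : ℂ} : z ∈ openSide n k ↔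
    ∃ w : ℝ, 0 < w ∧ w < 1 ∧ z = ent n ⟨(sideState n k).1, (sideState n k).2, w⟩ := by
  rw [openSide, openSegment_eq_image']
  simp only [Set.mem_image, Set.mem_Ioo, Complex.real_smul, ← vertex_add_sideVec, sideVec]
  exact ⟨fun ⟨w, hw, h⟩ => ⟨w, hw.1, hw.2, h.symm⟩, fun ⟨w, h1, h2, h⟩ => ⟨w, ⟨h1, h2⟩, h.symm⟩⟩

theorem mem_curve_iff {n : ℕ} {z : ℂ} : z ∈ curve n ↔ ∃ k < 3 * 4 ^ n, z ∈ side n k := by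
  simp [curve]

/-! ### Points, tiles and the open table -/

/-- The three lattice coordinates. -/
def crd (a b : ℝ) (i : Fin 3) : ℝ :=
  match i with
  | 0 => a
  | 1 => b
  | 2 => -a - b

/-- Coordinates of interior points of a tile. -/
def Inside (t : Tile) (a b : ℝ) : Prop := ∀ i, (t.get i : ℝ) < crd a b i ∧ crd a b i < t.get i + 1

/-- Coordinates of points of a closed tile. -/
def InClosed (t : Tile) (a b : ℝ) : Prop :=
  ∀ i, (t.get i : ℝ) ≤ crd a b i ∧ crd a b i ≤ t.get i + 1

theorem Inside.inClosed {t : Tile} {a b : ℝ} (h : Inside t a b) : InClosed t a b :=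
  fun i => ⟨(h i).1.le, (h i).2.le⟩

theorem Tile.cast_r {t : Tile} : (t.r : ℝ) = t.sum - t.p - t.q := by
  rw [show t.r = t.sum - t.p - t.q by unfold sum; ring]; push_cast; ring

/-- Along an open edge one coordinate is an integer and the others have constant integer part. -/
theorem crd_ent {t : Tile} (h : t.Valid) (d : Fin 3) {v : ℝ} (h0 : 0 < v) (h1 : v < 1)
    (i : Fin 3) :
    (i = (if t.sum = -1 then d + 1 else d + 2) → crd (entA ⟨t, d, v⟩) (entB ⟨t, d, v⟩) i =
      ((t.add d 0 0 (-1 - t.sum)).get i : ℤ)) ∧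
    (i ≠ (if t.sum = -1 then d + 1 else d + 2) →
      ((t.add d 0 0 (-1 - t.sum)).get i : ℝ) < crd (entA ⟨t, d, v⟩) (entB ⟨t, d, v⟩) i ∧
      crd (entA ⟨t, d, v⟩) (entB ⟨t, d, v⟩) i < ((t.add d 0 0 (-1 - t.sum)).get i : ℝ) + 1) := by
  have hr := t.cast_r
  rcases h with h | h <;> fin_cases d <;> fin_cases i <;>
    simp [crd, entA, entB, h, add, Tile.get] <;> simp [h] at hr <;>
    first | linarith | (constructor <;> linarith)

theorem crd_ent_zero {t : Tile} (h : t.Valid) (d : Fin 3) (i : Fin 3) :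
    ∃ m : ℤ, crd (entA ⟨t, d, 0⟩) (entB ⟨t, d, 0⟩) i = m := by
  rcases h with h | h <;> fin_cases d <;> fin_cases i <;>
    simp [crd, entA, entB, h]
  all_goals first
    | exact ⟨_, rfl⟩
    | exact ⟨t.p + 1, by push_cast; ring1⟩ | exact ⟨t.q + 1, by push_cast; ring1⟩
    | exact ⟨- t.p - t.q, by push_cast; ring1⟩ | exact ⟨- t.p - t.q - 1, by push_cast; ring1⟩
    | exact ⟨- t.p - t.q - 2, by push_cast; ring1⟩

theorem crd_ent_int {t : Tile} (h : t.Valid) (d : Fin 3) (v : ℝ) :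
    ∃ (i : Fin 3) (m : ℤ), crd (entA ⟨t, d, v⟩) (entB ⟨t, d, v⟩) i = m := by
  refine ⟨if t.sum = -1 then d + 1 else d + 2, ?_⟩
  rcases h with h | h <;> fin_cases d <;>
    simp [crd, entA, entB, h]
  all_goals first
    | exact ⟨_, rfl⟩
    | exact ⟨t.p + 1, by push_cast; ring1⟩ | exact ⟨t.q + 1, by push_cast; ring1⟩
    | exact ⟨- t.p - t.q - 1, by push_cast; ring1⟩

theorem ent_inj {n : ℕ} {t : Tile} (h : t.Valid) {d : Fin 3} {v w : ℝ}
    (he : ent n ⟨t, d, v⟩ = ent n ⟨t, d, w⟩) : v = w := by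
  obtain ⟨h1, h2⟩ := pos_inj he
  rcases h with h | h <;> fin_cases d <;> norm_num [entA, entB, h] at h1 h2 <;> linarith

theorem not_int_of_lt {x : ℝ} {m : ℤ} (h : (m : ℝ) < x ∧ x < m + 1) (k : ℤ) : x ≠ k := by
  rintro rfl
  have h1 : m < k := by exact_mod_cast h.1
  have h2 : k < m + 1 := by exact_mod_cast h.2
  omega

theorem int_eq_of_lt {x : ℝ} {m k : ℤ} (h : (m : ℝ) < x ∧ x < m + 1)
    (h' : (k : ℝ) ≤ x ∧ x ≤ k + 1) : m = k := by
  have h1 : m < k + 1 := by exact_mod_cast h.1.trans_le h'.2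
  have h2 : k < m + 1 := by exact_mod_cast h'.1.trans_lt h.2
  omega

/-- A point in the relative interior of an edge lies on this edge only, which has two
orientations. -/
theorem ent_eq_ent {n : ℕ} {t t' : Tile} (h : t.Valid) (h' : t'.Valid) {d d' : Fin 3} {v w : ℝ}
    (h0 : 0 < v) (h1 : v < 1) (w0 : 0 ≤ w) (w1 : w ≤ 1)
    (he : ent n ⟨t, d, v⟩ = ent n ⟨t', d', w⟩) :
    (t' = t ∧ d' = d ∧ w = v) ∨ (t' = t.prv d ∧ d' = t.baseDir d ∧ w = 1 - v) := by
  obtain ⟨hA, hB⟩ := pos_inj he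
  -- At a lattice point all three coordinates are integers, so this excludes `w = 0` and `w = 1`.
  have nonint : ∃ i, ∀ m : ℤ, crd (entA ⟨t, d, v⟩) (entB ⟨t, d, v⟩) i ≠ m := by
    obtain ⟨i, hi⟩ : ∃ i, i ≠ (if t.sum = -1 then d + 1 else d + 2) :=
      ⟨d, by split_ifs <;> clear * - <;> revert d <;> decide⟩
    exact ⟨i, not_int_of_lt ((crd_ent h d h0 h1 i).2 hi)⟩
  have w0' : 0 < w := by
    rcases w0.eq_or_lt with rfl | hw
    · obtain ⟨i, hi⟩ := nonint
      obtain ⟨m, hm⟩ := crd_ent_zero h' d' i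
      rw [hA, hB] at hi
      exact absurd hm (hi m)
    · exact hw
  have w1' : w < 1 := by
    rcases w1.eq_or_lt with rfl | hw
    · obtain ⟨i, hi⟩ := nonint
      rw [ent_one h'] at he
      obtain ⟨hA, hB⟩ := pos_inj he
      obtain ⟨m, hm⟩ := crd_ent_zero h' (d' + 1) i
      rw [hA, hB] at hi
      exact absurd hm (hi m)
    · exact hw
  have k1 := crd_ent h d h0 h1
  have k2 := crd_ent h' d' w0' w1'
  rw [← hA, ← hB] at k2
  -- The index of the only integer coordinate gives the line direction of the edge; the integer
  -- parts then locate it, up to the choice of the tile on either side.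
  have hidx : (if t.sum = -1 then d + 1 else d + 2) =
      (if t'.sum = -1 then d' + 1 else d' + 2) := by
    by_contra hne
    exact not_int_of_lt ((k2 _).2 hne) _ ((k1 _).1 rfl)
  have hfl : ∀ i, (t.add d 0 0 (-1 - t.sum)).get i = (t'.add d' 0 0 (-1 - t'.sum)).get i := by
    intro i
    by_cases hi : i = (if t.sum = -1 then d + 1 else d + 2)
    · have := (k2 i).1 (hi.trans hidx)
      rw [(k1 i).1 hi] at this
      exact_mod_cast this
    · have h3 := (k1 i).2 hi
      have h4 := (k2 i).2 (hidx ▸ hi)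
      exact int_eq_of_lt h3 ⟨h4.1.le, h4.2.le⟩
  have f0 := hfl 0; have f1 := hfl 1; have f2 := hfl 2
  have key : (t' = t ∧ d' = d) ∨ (t' = t.prv d ∧ d' = t.baseDir d) := by
    rcases h with h | h <;> rcases h' with h' | h' <;> simp only [h, h', if_true] at hidx f0 f1 f2 <;>
      norm_num at hidx f0 f1 f2
    · left
      subst hidx
      refine ⟨?_, rfl⟩
      fin_cases d <;> simp [add, Tile.get] at f0 f1 f2 <;> ext <;> simp [*]
    · right
      obtain rfl : d' = d + 2 := by clear * - hidx; revert d d'; decide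
      refine ⟨?_, by simp [baseDir, h]⟩
      fin_cases d <;> simp [add, Tile.get] at f0 f1 f2 <;> ext <;> simp [Tile.prv, h, add] <;> omega
    · right
      obtain rfl : d' = d + 1 := by clear * - hidx; revert d d'; decide
      refine ⟨?_, by simp [baseDir, h]⟩
      fin_cases d <;> simp [add, Tile.get] at f0 f1 f2 <;> ext <;> simp [Tile.prv, h, add] <;> omega
    · left
      subst hidx
      refine ⟨?_, rfl⟩
      fin_cases d <;> simp [add, Tile.get] at f0 f1 f2 <;> ext <;> simp [*]
  rcases key with ⟨rfl, rfl⟩ | ⟨rfl, rfl⟩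
  · exact Or.inl ⟨rfl, rfl, (ent_inj h he).symm⟩
  · rw [← ent_prv_baseDir h] at he
    exact Or.inr ⟨rfl, rfl, (ent_inj h' he).symm⟩

/-- The closed triangle of a tile. -/
def tileHull (n : ℕ) (t : Tile) : Set ℂ :=
  convexHull ℝ {ent n ⟨t, 0, 0⟩, ent n ⟨t, 1, 0⟩, ent n ⟨t, 2, 0⟩}

theorem mem_tileHull_of_inClosed {n : ℕ} {t : Tile} (h : t.Valid) {a b : ℝ} (hc : InClosed t a b) :
    pos n a b ∈ tileHull n t := by
  have hr := t.cast_r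
  have c0 := hc 0; have c1 := hc 1; have c2 := hc 2
  simp only [crd, Tile.get] at c0 c1 c2
  have comb : ∀ x y z : ℝ, 0 ≤ x → 0 ≤ y → 0 ≤ z → x + y + z = 1 →
      pos n a b = x * ent n ⟨t, 0, 0⟩ + y * ent n ⟨t, 1, 0⟩ + z * ent n ⟨t, 2, 0⟩ →
      pos n a b ∈ tileHull n t := by
    intro x y z hx hy hz hxyz he
    have := (convex_convexHull ℝ ({ent n ⟨t, 0, 0⟩, ent n ⟨t, 1, 0⟩, ent n ⟨t, 2, 0⟩} : Set ℂ)).sum_mem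
      (t := Finset.univ) (w := ![x, y, z])
      (z := ![ent n ⟨t, 0, 0⟩, ent n ⟨t, 1, 0⟩, ent n ⟨t, 2, 0⟩])
      (by intro i _; fin_cases i <;> simp [*]) (by simp [Fin.sum_univ_three, hxyz])
      (by intro i _; apply subset_convexHull; fin_cases i <;> simp)
    simpa [Fin.sum_univ_three, he, tileHull] using this
  -- The offsets of the three coordinates sum to `1` in an upward tile and serve as barycentric
  -- coordinates. In a downward tile they sum to `2`, and their complements to `1` are used.
  rcases h with h | h
  · simp [h] at hr
    refine comb (-a - b - t.r) (a - t.p) (b - t.q) (by linarith) (by linarith) (by linarith)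
      (by linarith) ?_
    simp [ent, pos, entA, entB, h, hr]
    ring
  · simp [h] at hr
    refine comb (1 - (a - t.p)) (1 - (b - t.q)) (1 - (-a - b - t.r)) (by linarith) (by linarith)
      (by linarith) (by linarith) ?_
    simp [ent, pos, entA, entB, h, hr]
    ring

theorem inClosed_of_mem_tileHull {n : ℕ} {t : Tile} (h : t.Valid) {z : ℂ} (hz : z ∈ tileHull n t) :
    ∃ a b, z = pos n a b ∧ InClosed t a b := by
  have hr := t.cast_r
  have hconv : Convex ℝ {z | ∃ a b, z = pos n a b ∧ InClosed t a b} := by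
    rintro _ ⟨a, b, rfl, h1⟩ _ ⟨a', b', rfl, h2⟩ x y hx hy hxy
    refine ⟨x * a + y * a', x * b + y * b', ?_, ?_⟩
    · simp [pos]; ring
    · intro i
      have h1 := h1 i
      have h2 := h2 i
      have e : crd (x * a + y * a') (x * b + y * b') i = x * crd a b i + y * crd a' b' i := by
        fin_cases i <;> simp [crd]; ring
      rw [e]
      obtain rfl : y = 1 - x := by linarith
      constructor <;> nlinarith
  refine convexHull_min ?_ hconv hz
  intro w hw
  simp only [Set.mem_insert_iff, Set.mem_singleton_iff] at hw
  rcases hw with rfl | rfl | rfl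
  all_goals
    refine ⟨_, _, rfl, fun i => ?_⟩
    rcases h with h | h <;> simp [h] at hr <;> fin_cases i <;>
      simp [crd, entA, entB, h, Tile.get] <;> first | linarith | (constructor <;> linarith)

theorem glue_valid {t : Tile} (h : t.Valid) (d : Fin 3) : (t.glue d).Valid := by
  have := sum_glue t d; unfold Valid at *; omega

theorem cell_eq (n k : ℕ) :
    cell n k = tileHull (n + 1) ((sideState n k).1.glue (sideState n k).2) := by
  have hv := sideState_valid n k
  obtain ⟨-, h1, h2, -⟩ := sideState_child n k
  have e1 := (vertex_sideVec_eq (n + 1) (4 * k + 1)).1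
  have e2 := (vertex_sideVec_eq (n + 1) (4 * k + 2)).1
  have e3 := vertex_add_sideVec (n + 1) (4 * k + 2) 1
  rw [Complex.ofReal_one, one_mul, sideVec, add_sub_cancel, ent_one (sideState_valid _ _)] at e3
  rw [h1] at e1
  rw [h2] at e2 e3
  rw [cell, tileHull, show 4 * k + 3 = 4 * k + 2 + 1 from rfl, e1, e2, e3]
  dsimp only
  generalize (sideState n k).1.glue (sideState n k).2 = u
  generalize (sideState n k).2 = d
  congr 1
  split_ifs <;> fin_cases d <;> simp <;> ext <;> simp <;> tauto

theorem table_zero : table 0 = tileHull 0 ⟨0, 0, -1⟩ := by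
  rw [table, tileHull, (vertex_sideVec_eq 0 0).1, (vertex_sideVec_eq 0 1).1,
    (vertex_sideVec_eq 0 2).1]
  rfl

theorem crd_div (a b : ℝ) (i : Fin 3) : crd (a / 3) (b / 3) i = crd a b i / 3 := by
  fin_cases i <;> simp [crd]; ring

theorem get_par (t : Tile) (i : Fin 3) : t.par.get i = t.get i / 3 := by
  fin_cases i <;> rfl

theorem ediv_bounds (m : ℤ) : 3 * ((m / 3 : ℤ) : ℝ) ≤ m ∧ (m : ℝ) ≤ 3 * ((m / 3 : ℤ) : ℝ) + 2 := by
  have : 3 * (m / 3) ≤ m ∧ m ≤ 3 * (m / 3) + 2 := by omega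
  exact_mod_cast this

theorem InClosed.par {t : Tile} {a b : ℝ} (h : InClosed t a b) :
    InClosed t.par (a / 3) (b / 3) := by
  intro i
  have h1 := h i
  have h2 := ediv_bounds (t.get i)
  rw [crd_div, get_par]
  constructor <;> linarith

theorem Inside.par {t : Tile} {a b : ℝ} (h : Inside t a b) :
    Inside t.par (a / 3) (b / 3) := by
  intro i
  have h1 := h i
  have h2 := ediv_bounds (t.get i)
  rw [crd_div, get_par]
  constructor <;> linarith

theorem Inside.eq {t t' : Tile} {a b : ℝ} (h : Inside t a b) (h' : InClosed t' a b) : t = t' := by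
  have := fun i => int_eq_of_lt (h i) (h' i)
  exact Tile.ext (this 0) (this 1) (this 2)

theorem mem_table_succ {n : ℕ} {z : ℂ} : z ∈ table (n + 1) ↔
    z ∈ table n ∨ ∃ k < 3 * 4 ^ n, z ∈ cell n k := by
  simp [table]

/-- The tiles of the table are contained in the table. -/
theorem mem_table_of_inClosed {n : ℕ} {t : Tile} {a b : ℝ} (ht : Tri n t) (h : InClosed t a b) :
    pos n a b ∈ table n := by
  induction n generalizing t a b with
  | zero =>
    obtain rfl : t = ⟨0, 0, -1⟩ := ht
    rw [table_zero]
    exact mem_tileHull_of_inClosed (Or.inl rfl) h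
  | succ n ih =>
    rw [mem_table_succ]
    by_cases hp : Tri n t.par
    · left
      rw [pos_succ]
      exact ih hp h.par
    · right
      have hv := ht.valid
      obtain ⟨e, he, hT⟩ := ht.2.resolve_left hp
      rw [he.par_prv hv] at hT
      have hb : (t.par.prv e).prv (t.baseDir e) = t.par := by
        rw [← par_glue hT.valid, ← he.eq_glue hv]
      obtain ⟨k, hk, hs⟩ := exists_sideState hT (by rwa [hb])
      refine ⟨k, hk, ?_⟩
      rw [cell_eq, hs]
      dsimp only
      rw [← he.eq_glue hv]
      exact mem_tileHull_of_inClosed hv h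

/-- The only tiles with interior points in the table are those of the table. -/
theorem tri_of_mem_table {n : ℕ} {t : Tile} {a b : ℝ} (hv : t.Valid) (h : Inside t a b)
    (hz : pos n a b ∈ table n) : Tri n t := by
  induction n generalizing t a b with
  | zero =>
    rw [table_zero] at hz
    obtain ⟨a', b', he, hc⟩ := inClosed_of_mem_tileHull (Or.inl rfl) hz
    obtain ⟨rfl, rfl⟩ := pos_inj he
    exact h.eq hc
  | succ n ih =>
    rcases mem_table_succ.1 hz with hz | ⟨k, hk, hz⟩
    · rw [pos_succ] at hz
      exact ⟨hv, Or.inl (ih hv.par h.par hz)⟩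
    · rw [cell_eq] at hz
      obtain ⟨a', b', he, hc⟩ := inClosed_of_mem_tileHull (glue_valid (sideState_valid _ _) _) hz
      obtain ⟨rfl, rfl⟩ := pos_inj he
      rw [h.eq hc]
      have := (sideState_spec (n + 1) (4 * k + 1) (by rw [pow_succ]; omega)).1
      rwa [(sideState_child n k).2.1] at this

/-- Every point of the polygon has an integer coordinate. -/
theorem Inside.not_mem_curve {n : ℕ} {t : Tile} {a b : ℝ} (h : Inside t a b) :
    pos n a b ∉ curve n := by
  intro hz
  obtain ⟨k, -, hz⟩ := mem_curve_iff.1 hz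
  obtain ⟨w, -, -, he⟩ := mem_side_iff.1 hz
  obtain ⟨i, m, hi⟩ := crd_ent_int (sideState_valid n k) (sideState n k).2 w
  obtain ⟨hA, hB⟩ := pos_inj he
  rw [← hA, ← hB] at hi
  exact not_int_of_lt (h i) m hi

theorem Inside.mem_openTable {n : ℕ} {t : Tile} {a b : ℝ} (ht : Tri n t) (h : Inside t a b) :
    pos n a b ∈ openTable n :=
  ⟨mem_table_of_inClosed ht h.inClosed, h.not_mem_curve⟩

theorem inClosed_ent {t : Tile} (h : t.Valid) (d : Fin 3) {v : ℝ} (h0 : 0 < v) (h1 : v < 1) :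
    InClosed t (entA ⟨t, d, v⟩) (entB ⟨t, d, v⟩) := by
  intro i
  have hr := t.cast_r
  rcases h with h | h <;> fin_cases d <;> fin_cases i <;>
    simp [crd, entA, entB, h, Tile.get] <;> simp [h] at hr <;>
    first | linarith | (constructor <;> linarith)

/-- The open edge between two tiles of the table lies in the open table. -/
theorem ent_mem_openTable {n : ℕ} {t : Tile} {d : Fin 3} {v : ℝ} (ht : Tri n t)
    (hp : Tri n (t.prv d)) (h0 : 0 < v) (h1 : v < 1) : ent n ⟨t, d, v⟩ ∈ openTable n := by
  refine ⟨mem_table_of_inClosed ht (inClosed_ent ht.valid d h0 h1), fun hz => ?_⟩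
  obtain ⟨k, hk, hz⟩ := mem_curve_iff.1 hz
  obtain ⟨w, w0, w1, he⟩ := mem_side_iff.1 hz
  have hs := (sideState_spec n k hk).2
  rcases ent_eq_ent ht.valid (sideState_valid n k) h0 h1 w0 w1 he with ⟨e1, e2, -⟩ | ⟨e1, e2, -⟩
  · rw [e1, e2] at hs; exact hs hp
  · rw [e1, e2] at hs
    apply hs
    rwa [prv_baseDir ht.valid]

/-- While a tile is crossed, the ball is in its interior. -/
theorem inside_move {n : ℕ} {t : Tile} (h : t.Valid) (d : Fin 3) {v T : ℝ} (h0 : 0 < v)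
    (h1 : v < 1) (hT : 0 < T) (hT' : T < len ⟨t, d, v⟩) :
    ∃ a b, ent n ⟨t, d, v⟩ + ((T / 3 ^ n : ℝ) : ℂ) * D d = pos n a b ∧ Inside t a b := by
  have hr := t.cast_r
  have mk : ∀ (x y : ℤ), D d = x + y * dir 1 →
      Inside t (entA ⟨t, d, v⟩ + T * x) (entB ⟨t, d, v⟩ + T * y) →
      ∃ a b, ent n ⟨t, d, v⟩ + ((T / 3 ^ n : ℝ) : ℂ) * D d = pos n a b ∧ Inside t a b := by
    intro x y hD hI
    refine ⟨_, _, ?_, hI⟩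
    rw [hD, ent, pos, pos]
    push_cast
    ring
  fin_cases d
  · refine mk 0 1 (by simp [D_zero]) fun i => ?_
    rcases h with h | h <;> simp [len, h] at hT' <;> fin_cases i <;>
      simp [crd, entA, entB, h, Tile.get] <;> simp [h] at hr <;>
      first | linarith | (constructor <;> linarith)
  · refine mk (-1) 0 (by simp [D_one]) fun i => ?_
    rcases h with h | h <;> simp [len, h] at hT' <;> fin_cases i <;>
      simp [crd, entA, entB, h, Tile.get] <;> simp [h] at hr <;>
      first | linarith | (constructor <;> linarith)
  · refine mk 1 (-1) (by simp [D_two]; ring) fun i => ?_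
    rcases h with h | h <;> simp [len, h] at hT' <;> fin_cases i <;>
      simp [crd, entA, entB, h, Tile.get] <;> simp [h] at hr <;>
      first | linarith | (constructor <;> linarith)

/-- Apart from its end on the old side, a new side runs in the interior of the coarse tile outside
that side; so new boundary avoids the old table. The apex `w = 1` is included. -/
theorem inside_glue {t : Tile} (h : t.Valid) (d : Fin 3) {w : ℝ} (h0 : 0 < w) (h1 : w ≤ 1) :
    Inside (t.prv d) (entA ⟨t.glue d, if t.sum = -1 then d else d + 2, w⟩ / 3)
      (entB ⟨t.glue d, if t.sum = -1 then d else d + 2, w⟩ / 3) := by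
  intro i
  have hr := t.cast_r
  have hs := sum_glue t d
  rcases h with h | h <;> rw [h] at hs <;> norm_num at hs <;> fin_cases d <;> dsimp at hs <;>
    fin_cases i <;> simp [crd, entA, entB, h, hs] <;>
    simp [glue, scale, add, h, Tile.get, Tile.prv] <;> simp [h] at hr <;>
    first | linarith | (constructor <;> linarith)

theorem inside_glue' {t : Tile} (h : t.Valid) (d : Fin 3) {w : ℝ} (h0 : 0 ≤ w) (h1 : w < 1) :
    Inside (t.prv d) (entA ⟨t.glue d, if t.sum = -1 then d + 1 else d, w⟩ / 3)
      (entB ⟨t.glue d, if t.sum = -1 then d + 1 else d, w⟩ / 3) := by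
  intro i
  have hr := t.cast_r
  have hs := sum_glue t d
  rcases h with h | h <;> rw [h] at hs <;> norm_num at hs <;> fin_cases d <;> dsimp at hs <;>
    fin_cases i <;> simp [crd, entA, entB, h, hs] <;>
    simp [glue, scale, add, h, Tile.get, Tile.prv] <;> simp [h] at hr <;>
    first | linarith | (constructor <;> linarith)

theorem mem_side_of_add {n k : ℕ} {w : ℝ} (h0 : 0 ≤ w) (h1 : w ≤ 1) :
    vertex n k + w * sideVec n k ∈ side n k :=
  mem_side_iff.2 ⟨w, h0, h1, vertex_add_sideVec n k w⟩

/-- The open tables increase. -/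
theorem openTable_subset_succ (n : ℕ) : openTable n ⊆ openTable (n + 1) := by
  rintro z ⟨hz, hc⟩
  refine ⟨mem_table_succ.2 (Or.inl hz), fun hz' => ?_⟩
  obtain ⟨k, hk, hk'⟩ := mem_curve_iff.1 hz'
  obtain ⟨l, hl⟩ := exists_child k
  have hl' : l < 3 * 4 ^ n := by rw [pow_succ] at hk; omega
  obtain ⟨w, w0, w1, he⟩ := mem_side_iff.1 hk'
  have he' := he
  rw [← vertex_add_sideVec] at he
  obtain ⟨v0, v1, v2, v3, -⟩ := vertex_child n l
  obtain ⟨s0, s1, s2, s3⟩ := sideVec_child n l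
  have onside : ∀ u : ℝ, 0 ≤ u → u ≤ 1 → z ≠ vertex n l + u * sideVec n l := by
    rintro u u0 u1 rfl
    exact hc (mem_curve_iff.2 ⟨l, hl', mem_side_of_add u0 u1⟩)
  have hv := sideState_valid n l
  -- A point inside the coarse tile beyond side `l` cannot be in the old table, because that tile is
  -- not part of it.
  have inside : ∀ a b, z = pos (n + 1) a b →
      ¬ Inside ((sideState n l).1.prv (sideState n l).2) (a / 3) (b / 3) := by
    rintro a b rfl hI
    rw [pos_succ] at hz
    exact (sideState_spec n l hl').2 (tri_of_mem_table (hv.prv _) hI hz)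
  obtain ⟨-, c1, c2, -⟩ := sideState_child n l
  rcases hl with rfl | rfl | rfl | rfl
  · exact onside (w / 3) (by linarith) (by linarith) (by rw [he, v0, s0]; push_cast; ring)
  · rcases w0.eq_or_lt with rfl | hw
    · exact onside (1 / 3) (by norm_num) (by norm_num) (by rw [he, v1]; push_cast; ring)
    · rw [c1] at he'
      exact inside _ _ he' (inside_glue hv _ hw w1)
  · rcases w1.eq_or_lt with rfl | hw
    · exact onside (2 / 3) (by norm_num) (by norm_num)
        (by rw [he, v2, s2, dir_neg_one]; push_cast; ring)
    · rw [c2] at he'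
      exact inside _ _ he' (inside_glue' hv _ w0 hw)
  · exact onside (2 / 3 + w / 3) (by linarith) (by linarith)
      (by rw [he, v3, s3]; push_cast; ring)

/-! ### From the flow to the billiard map -/

open Relation

/-- The phase point of the billiard belonging to a state. -/
noncomputable def ph (n : ℕ) (s : State) : ℂ × ℂ := (ent n s, D s.d)

theorem sideVec_eq (n k : ℕ) : sideVec n k =
    dir (edgeDir (sideState n k).1 (sideState n k).2) * ((1 / 3 ^ n : ℝ) : ℂ) := by
  rw [(vertex_sideVec_eq n k).2]; push_cast; ring

theorem ent_mem_openSide {n k : ℕ} {t : Tile} {d : Fin 3} (hs : sideState n k = (t, d)) {v : ℝ}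
    (h0 : 0 < v) (h1 : v < 1) : ent n ⟨t, d, v⟩ ∈ openSide n k :=
  mem_openSide_iff.2 ⟨v, h0, h1, by rw [hs]⟩

theorem openSide_subset_curve {n k : ℕ} (hk : k < 3 * 4 ^ n) : openSide n k ⊆ curve n :=
  fun _ hz => mem_curve_iff.2 ⟨k, hk, openSegment_subset_segment _ _ _ hz⟩

theorem sideState_eq_of_mem {n k : ℕ} (hk : k < 3 * 4 ^ n) {t : Tile} (ht : t.Valid)
    {d : Fin 3} (hp : ¬ Tri n (t.prv d)) {v : ℝ} (h0 : 0 < v) (h1 : v < 1)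
    (hz : ent n ⟨t, d, v⟩ ∈ openSide n k) : sideState n k = (t, d) := by
  obtain ⟨w, w0, w1, he⟩ := mem_openSide_iff.1 hz
  rcases ent_eq_ent ht (sideState_valid n k) h0 h1 w0.le w1.le he with ⟨e1, e2, -⟩ | ⟨e1, -, -⟩
  · exact Prod.ext e1 e2
  · exact absurd (e1 ▸ (sideState_spec n k hk).1) hp

theorem sideVec_unique {n k k' : ℕ} (hk : k < 3 * 4 ^ n) (hk' : k' < 3 * 4 ^ n) {z : ℂ}
    (hz : z ∈ openSide n k) (hz' : z ∈ openSide n k') : sideVec n k = sideVec n k' := by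
  obtain ⟨w, w0, w1, rfl⟩ := mem_openSide_iff.1 hz
  have := sideState_eq_of_mem hk' (sideState_valid n k)
    (sideState_spec n k hk).2 w0 w1 hz'
  rw [sideVec_eq, sideVec_eq, this]

/-- The billiard map is single-valued. -/
theorem step_unique {n : ℕ} {p q q' : ℂ × ℂ} (h : Step n p q) (h' : Step n p q') : q = q' := by
  obtain ⟨T, hT, e1, ho, k, hk, hz, e2⟩ := h
  obtain ⟨T', hT', e1', ho', k', hk', hz', e2'⟩ := h'
  have c := openSide_subset_curve hk hz
  have c' := openSide_subset_curve hk' hz'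
  rcases lt_trichotomy T T' with h | rfl | h
  · rw [e1] at c
    exact absurd c (ho' T hT h).2
  · have e : q.1 = q'.1 := by rw [e1, e1']
    rw [← e] at hz'
    exact Prod.ext e (by rw [e2, e2', sideVec_unique hk hk' hz hz'])
  · rw [e1'] at c'
    exact absurd c' (ho T' hT' h).2

section Deterministic

variable {α : Type*} {R : α → α → Prop}

theorem transGen_of_step (hR : ∀ a b c, R a b → R a c → b = c) {a b : α} (h : TransGen R a a)
    (hab : R a b) : ReflTransGen R b a ∧ TransGen R b b := by
  obtain ⟨c, hc, hca⟩ := TransGen.head'_iff.1 h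
  obtain rfl := hR _ _ _ hab hc
  exact ⟨hca, TransGen.tail' hca hab⟩

theorem transGen_of_reflTransGen (hR : ∀ a b c, R a b → R a c → b = c) {a b : α}
    (h : TransGen R a a) (hab : ReflTransGen R a b) : ReflTransGen R b a ∧ TransGen R b b := by
  induction hab with
  | refl => exact ⟨.refl, h⟩
  | tail _ h2 ih =>
    obtain ⟨h3, h4⟩ := transGen_of_step hR ih.2 h2
    exact ⟨h3.trans ih.1, h4⟩

end Deterministic

theorem orbit_eq {n : ℕ} {p q : ℂ × ℂ} (h : TransGen (Step n) p p) (hq : q ∈ orbit n p) :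
    orbit n q = orbit n p := by
  have := (transGen_of_reflTransGen (R := Step n) (fun _ _ _ => step_unique) h hq).1
  ext r
  exact ⟨fun hr => hq.trans hr, fun hr => this.trans hr⟩

theorem mem_openTable_of_lt_len {n : ℕ} {s : State} (hs : Tri n s.tile) (h0 : 0 < s.v)
    (h1 : s.v < 1) {τ : ℝ} (hτ : 0 < τ) (hτ' : τ < len s / 3 ^ n) :
    ent n s + (τ : ℂ) * D s.d ∈ openTable n := by
  have h3 : (0 : ℝ) < 3 ^ n := by positivity
  obtain ⟨a, b, he, hI⟩ := inside_move (n := n) (T := τ * 3 ^ n) hs.valid s.d h0 h1 (by positivity)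
    ((lt_div_iff₀ h3).1 hτ')
  rw [mul_div_cancel_right₀ _ h3.ne'] at he
  rw [he]
  exact hI.mem_openTable hs

theorem Straight.path {n : ℕ} {b s : State} (h : Straight n b s) (hb : Tri n b.tile)
    (h0 : 0 < b.v) (h1 : b.v < 1) : ∃ T : ℝ, 0 ≤ T ∧ ent n s = ent n b + (T : ℂ) * D b.d ∧
      (∀ t : ℝ, 0 < t → t < T → ent n b + (t : ℂ) * D b.d ∈ openTable n) ∧
      (T = 0 ∨ ent n s ∈ openTable n) := by
  induction h with
  | refl => exact ⟨0, le_rfl, by simp, fun t h h' => by linarith, Or.inl rfl⟩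
  | @step s hs hn ih =>
    obtain ⟨T, hT, he, ho, hl⟩ := ih
    have hst := hs.tri hb
    have hv := hs.v_eq
    have hd := hs.d_eq
    have h3 : (0 : ℝ) < 3 ^ n := by positivity
    have hlen : 0 < len s / 3 ^ n := div_pos (len_pos hst.valid (hv ▸ h0) (hv ▸ h1)) h3
    refine ⟨T + len s / 3 ^ n, by linarith, ?_, ?_, Or.inr ?_⟩
    · rw [ent_nxt hst.valid, show (⟨s.tile, s.d, s.v⟩ : State) = s from rfl, he, hd]
      push_cast; ring
    · intro t ht ht'
      rcases lt_trichotomy t T with h | rfl | h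
      · exact ho t ht h
      · rw [← he]
        exact hl.resolve_left ht.ne'
      · have := mem_openTable_of_lt_len hst (hv ▸ h0) (hv ▸ h1) (sub_pos.2 h) (by linarith)
        rw [he, hd] at this
        convert this using 1
        push_cast; ring
    · exact ent_mem_openTable hn (by rwa [prv_nxt]) (hv ▸ h0) (hv ▸ h1)

theorem reflect_edge {n k : ℕ} {t : Tile} (h : t.Valid) (d : Fin 3)
    (hs : sideState n k = (t, t.turn d)) : reflect (sideVec n k) (D d) = D (t.turn d) := by
  rw [sideVec_eq, hs, D, reflect_dir _ _ (by positivity), D]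
  apply dir_eq_of_dvd
  rcases h with h | h <;> simp only [edgeDir, turn, h] <;> fin_cases d <;> decide

/-- A reflection of the flow is a collision of the billiard. -/
theorem Straight.step_billiard {n : ℕ} {b s : State} (h : Straight n b s) (hb : Tri n b.tile)
    (h0 : 0 < b.v) (h1 : b.v < 1) (hn : ¬ Tri n (s.tile.nxt s.d)) :
    Step n (ph n b) (ph n ⟨s.tile, s.tile.turn s.d, 1 - s.v⟩) ∧
      Bdry n ⟨s.tile, s.tile.turn s.d, 1 - s.v⟩ := by
  obtain ⟨T, hT, he, ho, hl⟩ := h.path hb h0 h1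
  have hst := h.tri hb
  have hv := h.v_eq
  have hd := h.d_eq
  have h3 : (0 : ℝ) < 3 ^ n := by positivity
  have hlen : 0 < len s / 3 ^ n := div_pos (len_pos hst.valid (hv ▸ h0) (hv ▸ h1)) h3
  have hp : ¬ Tri n (s.tile.prv (s.tile.turn s.d)) := by rwa [prv_turn hst.valid]
  refine ⟨⟨T + len s / 3 ^ n, by linarith, ?_, ?_, ?_⟩, hst, hp⟩
  · dsimp only [ph]
    rw [ent_turn hst.valid, show (⟨s.tile, s.d, s.v⟩ : State) = s from rfl, he, hd]
    push_cast; ring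
  · intro t ht ht'
    dsimp only [ph]
    rcases lt_trichotomy t T with h | rfl | h
    · exact ho t ht h
    · rw [← he]
      exact hl.resolve_left ht.ne'
    · have := mem_openTable_of_lt_len hst (hv ▸ h0) (hv ▸ h1) (sub_pos.2 h) (by linarith)
      rw [he, hd] at this
      convert this using 1
      push_cast; ring
  · obtain ⟨k, hk, hs⟩ := exists_sideState hst hp
    exact ⟨k, hk, ent_mem_openSide hs (by linarith) (by linarith),
      by dsimp only [ph]; rw [← hd, reflect_edge hst.valid _ hs]⟩

/-- The flow follows the billiard orbit. -/
theorem exists_bdry_straight {n : ℕ} {b : State} (hb : Bdry n b) (h0 : 0 < b.v) (h1 : b.v < 1)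
    (i : ℕ) : ∃ b', Bdry n b' ∧ ReflTransGen (Step n) (ph n b) (ph n b') ∧
      Straight n b' ((flow n)^[i] b) := by
  induction i with
  | zero => exact ⟨b, hb, .refl, .refl⟩
  | succ i ih =>
    obtain ⟨b', hb', hr, hs⟩ := ih
    have hv : ((flow n)^[i] b).v = b'.v := hs.v_eq
    rw [Function.iterate_succ_apply']
    have hvi := flow_iterate_v n b i
    generalize (flow n)^[i] b = s at *
    by_cases hn : Tri n (s.tile.nxt s.d)
    · refine ⟨b', hb', hr, ?_⟩
      have := hs.step hn
      rwa [flow, if_pos hn]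
    · obtain ⟨h2, h3⟩ := hs.step_billiard hb'.1 (by rcases hvi with h | h <;> linarith)
        (by rcases hvi with h | h <;> linarith) hn
      refine ⟨_, h3, hr.tail h2, ?_⟩
      rw [flow, if_neg hn]
      exact .refl

theorem Reaches.reflTransGen {n : ℕ} {b b' : State} (hb : Bdry n b) (hb' : Bdry n b')
    (h0 : 0 < b.v) (h1 : b.v < 1) (h : Reaches n b b') :
    ReflTransGen (Step n) (ph n b) (ph n b') := by
  obtain ⟨i, rfl⟩ := h
  obtain ⟨b₁, hb₁, hr, hs⟩ := exists_bdry_straight hb h0 h1 i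
  rwa [hs.eq_of_bdry hb₁.1 hb']

/-- Without a collision the height would grow forever, against periodicity of the flow. -/
theorem exists_step {n : ℕ} {b : State} (hb : Bdry n b) (h0 : 0 < b.v) (h1 : b.v < 1) :
    ∃ b', Bdry n b' ∧ Step n (ph n b) (ph n b') ∧ (b'.v = b.v ∨ b'.v = 1 - b.v) := by
  by_contra hcon
  have key : ∀ i, Straight n b ((flow n)^[i] b) ∧
      ((flow n)^[i] b).tile.height b.d = b.tile.height b.d + i := by
    intro i
    induction i with
    | zero => exact ⟨.refl, by simp⟩
    | succ i ih =>
      rw [Function.iterate_succ_apply']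
      obtain ⟨hs, hh⟩ := ih
      generalize (flow n)^[i] b = s at *
      by_cases hn : Tri n (s.tile.nxt s.d)
      · rw [flow, if_pos hn]
        refine ⟨hs.step hn, ?_⟩
        have := height_nxt s.tile s.d
        dsimp only
        rw [hs.d_eq] at this ⊢
        push_cast
        omega
      · obtain ⟨h2, h3⟩ := hs.step_billiard hb.1 h0 h1 hn
        exact absurd ⟨_, h3, h2, Or.inr (by dsimp only; rw [hs.v_eq])⟩ hcon
  obtain ⟨P, hP, he⟩ := exists_period hb.1
  have := (key P).2
  rw [he] at this
  omega

/-- The last step of a period of the flow ends in the boundary state `b`. It cannot be a crossing,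
which would put the tile behind `b` into the table; so it is a collision, and the billiard orbit
closes up there. -/
theorem transGen_self {n : ℕ} {b : State} (hb : Bdry n b) (h0 : 0 < b.v) (h1 : b.v < 1) :
    TransGen (Step n) (ph n b) (ph n b) := by
  obtain ⟨P, hP, he⟩ := exists_period hb.1
  obtain ⟨i, rfl⟩ := Nat.exists_eq_succ_of_ne_zero hP.ne'
  obtain ⟨b', hb', hr, hs⟩ := exists_bdry_straight hb h0 h1 i
  have hvi := flow_iterate_v n b i
  rw [Nat.succ_eq_add_one, Function.iterate_succ_apply'] at he
  have hv := hs.v_eq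
  have hst := hs.tri hb'.1
  generalize (flow n)^[i] b = s at *
  by_cases hn : Tri n (s.tile.nxt s.d)
  · rw [flow, if_pos hn] at he
    have := hb.2
    rw [← he] at this
    dsimp only at this
    rw [prv_nxt] at this
    exact absurd hst this
  · rw [flow, if_neg hn] at he
    have := (hs.step_billiard hb'.1 (by rcases hvi with h | h <;> linarith)
        (by rcases hvi with h | h <;> linarith) hn).1
    rw [he] at this
    exact TransGen.tail' hr this

theorem exists_of_mem_orbit {n : ℕ} {b : State} (hb : Bdry n b) (h0 : 0 < b.v) (h1 : b.v < 1)
    {q : ℂ × ℂ} (hq : q ∈ orbit n (ph n b)) :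
    ∃ b', Bdry n b' ∧ q = ph n b' ∧ (b'.v = b.v ∨ b'.v = 1 - b.v) := by
  induction hq with
  | refl => exact ⟨b, hb, rfl, Or.inl rfl⟩
  | tail _ h2 ih =>
    obtain ⟨b', hb', rfl, hv⟩ := ih
    obtain ⟨b₂, hb₂, hs, hv₂⟩ := exists_step hb' (by rcases hv with h | h <;> linarith)
      (by rcases hv with h | h <;> linarith)
    refine ⟨b₂, hb₂, step_unique h2 hs, ?_⟩
    rcases hv with h | h <;> rcases hv₂ with h' | h' <;> rw [h'] <;> simp [h]

/-- The side on which a boundary state lies. -/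
theorem Bdry.exists_side {n : ℕ} {b : State} (hb : Bdry n b) (h0 : 0 < b.v) (h1 : b.v < 1) :
    ∃ k < 3 * 4 ^ n, sideState n k = (b.tile, b.d) ∧ ent n b ∈ openSide n k ∧
      ent n b = vertex n k + b.v * sideVec n k := by
  obtain ⟨k, hk, hs⟩ := exists_sideState hb.1 hb.2
  refine ⟨k, hk, hs, ent_mem_openSide hs h0 h1, ?_⟩
  rw [vertex_add_sideVec, hs]

theorem conj_sideVec_mul_im (n k : ℕ) (j : ℤ) :
    ((starRingEnd ℂ) (sideVec n k) * dir j).im =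
      (1 / 3 ^ n) * (dir (j - edgeDir (sideState n k).1 (sideState n k).2)).im := by
  rw [sideVec_eq, map_mul, conj_dir, Complex.conj_ofReal, mul_right_comm, ← dir_add,
    Complex.im_mul_ofReal, neg_add_eq_sub, mul_comm]

theorem dir_im_pos_iff (j : ℤ) : 0 < (dir j).im ↔ j % 6 = 1 ∨ j % 6 = 2 := by
  have h3 : 0 < √(3 : ℝ) := by positivity
  have e : dir j = dir (j % 6) := dir_eq_of_dvd (Int.dvd_self_sub_emod)
  have h1 : (dir 1).im = √3 / 2 := by rw [dir_one]
  have : 0 ≤ j % 6 ∧ j % 6 < 6 := by omega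
  rw [e]
  generalize j % 6 = i at *
  obtain ⟨h, h'⟩ := this
  interval_cases i <;> simp [dir_zero, dir_two, dir_three, dir_four, dir_five, h1] <;> positivity

theorem Bdry.isInward {n : ℕ} {b : State} (hb : Bdry n b) (h0 : 0 < b.v) (h1 : b.v < 1) :
    IsInward n (ent n b) (D b.d) := by
  obtain ⟨k, hk, hs, hz, -⟩ := hb.exists_side h0 h1
  refine ⟨k, hk, hz, ?_⟩
  rw [D, conj_sideVec_mul_im, hs]
  refine mul_pos (by positivity) ((dir_im_pos_iff _).2 ?_)
  rcases hb.1.valid with h | h <;> simp only [edgeDir, h] <;> omega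

/-! ### Ternary expansions and the Cantor set -/

/-- Ternary digit sequences with infinitely many `0`s and infinitely many `2`s. -/
def Mixed (a : ℕ → Fin 3) : Prop := {i | a i = 0}.Infinite ∧ {i | a i = 2}.Infinite

theorem infinite_shift_iff {p : ℕ → Prop} (n : ℕ) :
    {i | p (i + n)}.Infinite ↔ {i | p i}.Infinite := by
  simp only [← Nat.frequently_atTop_iff_infinite]
  constructor
  · intro h
    rw [Filter.frequently_atTop] at *
    intro k
    obtain ⟨b, hb, hp⟩ := h k
    exact ⟨b + n, by omega, hp⟩
  · intro h
    rw [Filter.frequently_atTop] at *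
    intro k
    obtain ⟨b, hb, hp⟩ := h (k + n)
    exact ⟨b - n, by omega, by rwa [Nat.sub_add_cancel (by omega)]⟩

theorem mixed_shift_iff {a : ℕ → Fin 3} (n : ℕ) : Mixed (fun i => a (i + n)) ↔ Mixed a :=
  and_congr (infinite_shift_iff (p := fun i => a i = 0) n)
    (infinite_shift_iff (p := fun i => a i = 2) n)

theorem ofDigits_cons (a : ℕ → Fin 3) :
    Real.ofDigits a = (((a 0 : ℕ) : ℝ) + Real.ofDigits (fun i => a (i + 1))) / 3 := by
  rw [Real.ofDigits_eq_sum_add_ofDigits a 1]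
  simp [Real.ofDigitsTerm]
  ring

theorem ofDigits_pos {a : ℕ → Fin 3} {n : ℕ} (h : a n = 2) : 0 < Real.ofDigits a := by
  induction n generalizing a with
  | zero =>
    rw [ofDigits_cons, h]
    have := Real.ofDigits_nonneg (fun i => a (i + 1))
    norm_num
    linarith
  | succ n ih =>
    rw [ofDigits_cons]
    have := ih (a := fun i => a (i + 1)) h
    positivity

theorem ofDigits_lt_one {a : ℕ → Fin 3} {n : ℕ} (h : a n = 0) : Real.ofDigits a < 1 := by
  induction n generalizing a with
  | zero =>
    rw [ofDigits_cons, h]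
    have := Real.ofDigits_le_one (fun i => a (i + 1))
    norm_num
    linarith
  | succ n ih =>
    rw [ofDigits_cons]
    have h1 := ih (a := fun i => a (i + 1)) h
    have h2 : ((a 0 : ℕ) : ℝ) ≤ 2 := by exact_mod_cast Nat.le_of_lt_succ (a 0).isLt
    linarith

theorem Mixed.ofDigits_mem {a : ℕ → Fin 3} (h : Mixed a) :
    0 < Real.ofDigits a ∧ Real.ofDigits a < 1 := by
  obtain ⟨i, hi⟩ := h.1.nonempty
  obtain ⟨j, hj⟩ := h.2.nonempty
  exact ⟨ofDigits_pos hj, ofDigits_lt_one hi⟩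

theorem exists_mul_ofDigits (n : ℕ) (a : ℕ → Fin 3) :
    ∃ m : ℕ, 3 ^ n * Real.ofDigits a = m + Real.ofDigits (fun i => a (i + n)) := by
  induction n with
  | zero => exact ⟨0, by simp⟩
  | succ n ih =>
    obtain ⟨m, hm⟩ := ih
    refine ⟨3 * m + a n, ?_⟩
    rw [pow_succ, mul_comm _ (3 : ℝ), mul_assoc, hm, ofDigits_cons]
    simp only [zero_add]
    push_cast
    simp only [add_assoc, add_comm 1 n]
    ring

/-- A digit sequence may be preceded by the digits of an integer. -/
theorem exists_ofDigits_eq (n p : ℕ) (hp : p < 3 ^ n) (b : ℕ → Fin 3) :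
    ∃ a : ℕ → Fin 3, (p + Real.ofDigits b) / 3 ^ n = Real.ofDigits a ∧ ∀ i, a (i + n) = b i := by
  induction n generalizing p b with
  | zero =>
    obtain rfl : p = 0 := by simpa using hp
    exact ⟨b, by simp, fun i => rfl⟩
  | succ n ih =>
    -- The last ternary digit of `p` is moved to the front of `b`.
    obtain ⟨a, h1, h2⟩ := ih (p / 3) (by rw [pow_succ] at hp; omega)
      (fun i => if i = 0 then ⟨p % 3, Nat.mod_lt _ (by norm_num)⟩ else b (i - 1))
    refine ⟨a, ?_, fun i => ?_⟩
    rotate_left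
    · rw [add_comm n 1, ← add_assoc, h2]; simp
    rw [← h1, ofDigits_cons (fun i => if i = 0 then _ else b (i - 1))]
    simp only [if_true, Nat.add_eq_zero_iff, one_ne_zero, and_false, if_false, Nat.add_sub_cancel]
    have h3 : (p : ℝ) = 3 * ((p / 3 : ℕ) : ℝ) + ((p % 3 : ℕ) : ℝ) := by
      exact_mod_cast (Nat.div_add_mod p 3).symm
    rw [h3, pow_succ, div_eq_div_iff (by positivity) (by positivity)]
    ring

theorem ofDigits_rev (a : ℕ → Fin 3) :
    Real.ofDigits (fun i => Fin.rev (a i)) = 1 - Real.ofDigits a := by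
  rw [eq_sub_iff_add_eq, ← Real.ofDigits_const_last_eq_one' (b := 3) (by norm_num)]
  unfold Real.ofDigits
  rw [← Summable.tsum_add Real.summable_ofDigitsTerm Real.summable_ofDigitsTerm]
  congr 1
  ext i
  simp only [Real.ofDigitsTerm]
  rw [← add_mul]
  congr 1
  generalize a i = x
  fin_cases x <;> simp [Fin.rev]; norm_num

/-- Points of the Cantor set whose expansion without `1`s has infinitely many `0`s and infinitely
many `2`s. -/
def cantorCore : Set ℝ := {u | ∃ b : ℕ → Fin 3, u = Real.ofDigits b ∧ (∀ i, b i ≠ 1) ∧ Mixed b}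

/-- The expansion `a` with infinitely many `0`s and `2`s need not be the one without `1`s. But all
tails of `a` have value strictly between `0` and `1`; this carries over to the tails of `b`, which
therefore never become constantly `0` or `2`. -/
theorem cantorPrime_subset : cantorPrime ⊆ cantorCore := by
  rintro u ⟨hu, a, rfl, h0, h2⟩
  have ha : Mixed a := ⟨h0, h2⟩
  rw [cantorSet_eq_zero_two_ofDigits] at hu
  obtain ⟨b, hb, he⟩ := hu
  have key : ∀ n, 0 < Real.ofDigits (fun i => b (i + n)) ∧ Real.ofDigits (fun i => b (i + n)) < 1 := by
    intro n
    obtain ⟨m, hm⟩ := exists_mul_ofDigits n a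
    obtain ⟨m', hm'⟩ := exists_mul_ofDigits n b
    rw [he, hm] at hm'
    obtain ⟨p1, p2⟩ := ((mixed_shift_iff n).2 ha).ofDigits_mem
    have q1 := Real.ofDigits_nonneg (fun i => b (i + n))
    have q2 := Real.ofDigits_le_one (fun i => b (i + n))
    have e1 : (m : ℝ) < m' + 1 := by linarith
    have e2 : (m' : ℝ) < m + 1 := by linarith
    -- The two decompositions of `3 ^ n` times the number have equal integer parts, as one
    -- fractional part is strictly inside the unit interval.
    obtain rfl : m = m' := by
      have e1 : m < m' + 1 := by exact_mod_cast e1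
      have e2 : m' < m + 1 := by exact_mod_cast e2
      omega
    constructor <;> linarith
  refine ⟨b, he.symm, hb, ?_, ?_⟩
  · rw [← Nat.frequently_atTop_iff_infinite, Filter.frequently_atTop]
    by_contra! hcon
    obtain ⟨n, hn⟩ := hcon
    have : (fun i => b (i + n)) = fun _ => 2 := by
      funext i
      have h1 := hn (i + n) (by omega)
      have h2 := hb (i + n)
      generalize b (i + n) = x at *
      revert x; decide
    have h := (key n).2
    rw [this] at h
    have := Real.ofDigits_const_last_eq_one' (b := 3) (by norm_num)
    exact absurd this (ne_of_lt h)
  · rw [← Nat.frequently_atTop_iff_infinite, Filter.frequently_atTop]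
    by_contra! hcon
    obtain ⟨n, hn⟩ := hcon
    have : (fun i => b (i + n)) = fun _ => 0 := by
      funext i
      have h1 := hn (i + n) (by omega)
      have h2 := hb (i + n)
      generalize b (i + n) = x at *
      revert x; decide
    have h := (key n).1
    rw [this] at h
    simp [Real.ofDigits, Real.ofDigitsTerm] at h

theorem cantorCore_pos {u : ℝ} (h : u ∈ cantorCore) : 0 < u ∧ u < 1 := by
  obtain ⟨b, rfl, -, hb⟩ := h
  exact hb.ofDigits_mem

theorem cantorCore_one_sub {u : ℝ} (h : u ∈ cantorCore) : 1 - u ∈ cantorCore := by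
  obtain ⟨b, rfl, h1, h0, h2⟩ := h
  refine ⟨_, (ofDigits_rev b).symm, fun i => ?_, ?_, ?_⟩
  · have := h1 i
    generalize b i = x at *
    revert x; decide
  · convert h2 using 3 with i
    dsimp only
    generalize b i = x
    clear * -
    revert x; decide
  · convert h0 using 3 with i
    dsimp only
    generalize b i = x
    clear * -
    revert x; decide

theorem cantorCore_cases {u : ℝ} (h : u ∈ cantorCore) :
    ∃ u' ∈ cantorCore, u = u' / 3 ∨ u = 2 / 3 + u' / 3 := by
  obtain ⟨b, rfl, h1, h2⟩ := h
  refine ⟨_, ⟨fun i => b (i + 1), rfl, fun i => h1 _, (mixed_shift_iff 1).2 h2⟩, ?_⟩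
  rw [ofDigits_cons]
  have := h1 0
  have h3 : b 0 = 0 ∨ b 0 = 2 := by
    generalize b 0 = x at *
    revert x; decide
  rcases h3 with h3 | h3 <;> rw [h3]
  · left; simp
  · right; norm_num; ring

theorem isCantorBase_of_cantorCore {n : ℕ} {p : ℤ} {u : ℝ} (hp : 0 ≤ p) (hp' : p < 3 ^ n)
    (hu : u ∈ cantorCore) : IsCantorBase (((p + u) / 3 ^ n : ℝ) : ℂ) := by
  obtain ⟨b, rfl, h1, h0, h2⟩ := hu
  lift p to ℕ using hp
  obtain ⟨a, ha, hab⟩ := exists_ofDigits_eq n p (by exact_mod_cast hp') b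
  -- Only the first `n` digits, those of `p`, can be equal to `1`.
  refine ⟨a, by rw [← ha]; simp, ?_, ?_, ?_⟩
  · refine (Set.finite_Iio n).subset fun i hi => ?_
    by_contra hin
    have := hab (i - n)
    rw [Nat.sub_add_cancel (by simpa using hin)] at this
    exact h1 _ (this.symm.trans hi)
  · exact (infinite_shift_iff (p := fun i => a i = 0) n).1 (by simpa only [hab] using h0)
  · exact (infinite_shift_iff (p := fun i => a i = 2) n).1 (by simpa only [hab] using h2)

/-- Points as in `IsCantorBase` lie in the interior of a side of every lattice. -/
theorem IsCantorBase.exists_eq {z : ℂ} (h : IsCantorBase z) (n : ℕ) :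
    ∃ (p : ℤ) (v : ℝ), 0 ≤ p ∧ p < 3 ^ n ∧ 0 < v ∧ v < 1 ∧ z = (((p + v) / 3 ^ n : ℝ) : ℂ) := by
  obtain ⟨a, rfl, -, ha⟩ := h
  have ha : Mixed a := ha
  obtain ⟨m, hm⟩ := exists_mul_ofDigits n a
  obtain ⟨h0, h1⟩ := ((mixed_shift_iff n).2 ha).ofDigits_mem
  obtain ⟨h0', h1'⟩ := ha.ofDigits_mem
  have h3 : (0 : ℝ) < 3 ^ n := by positivity
  refine ⟨m, _, by positivity, ?_, h0, h1, ?_⟩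
  · have : (m : ℝ) < 3 ^ n := by nlinarith
    exact_mod_cast this
  · congr 1
    rw [eq_div_iff h3.ne', mul_comm, hm]
    simp

/-! ### Orbits under refinement of the table -/

/-- Points of the Cantor type set on some side of the `n`-th polygon. -/
def Good (n : ℕ) (z : ℂ) : Prop :=
  ∃ k < 3 * 4 ^ n, ∃ u ∈ cantorCore, z = vertex n k + (u : ℂ) * sideVec n k

theorem mem_openSide_of_add {n k : ℕ} {w : ℝ} (h0 : 0 < w) (h1 : w < 1) :
    vertex n k + w * sideVec n k ∈ openSide n k :=
  mem_openSide_iff.2 ⟨w, h0, h1, vertex_add_sideVec n k w⟩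

theorem exists_child_side {n k : ℕ} (hk : k < 3 * 4 ^ n) {u : ℝ} (hu : u ∈ cantorCore) :
    ∃ k' < 3 * 4 ^ (n + 1), ∃ u' ∈ cantorCore,
      vertex n k + (u : ℂ) * sideVec n k = vertex (n + 1) k' + (u' : ℂ) * sideVec (n + 1) k' ∧
      sideVec n k = sideVec (n + 1) k' * ((3 : ℝ) : ℂ) := by
  obtain ⟨u', hu', h⟩ := cantorCore_cases hu
  obtain ⟨v0, -, -, v3, -⟩ := vertex_child n k
  obtain ⟨s0, -, -, s3⟩ := sideVec_child n k
  rcases h with rfl | rfl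
  · exact ⟨4 * k, by rw [pow_succ]; omega, u', hu', by rw [v0, s0]; push_cast; ring,
      by rw [s0]; push_cast; ring⟩
  · exact ⟨4 * k + 3, by rw [pow_succ]; omega, u', hu', by rw [v3, s3]; push_cast; ring,
      by rw [s3]; push_cast; ring⟩

theorem Good.succ {n : ℕ} {z : ℂ} (h : Good n z) : Good (n + 1) z := by
  obtain ⟨k, hk, u, hu, rfl⟩ := h
  obtain ⟨k', hk', u', hu', h1, -⟩ := exists_child_side hk hu
  exact ⟨k', hk', u', hu', h1⟩

/-- A side containing a Cantor type point has a subside of the next polygon containing it. -/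
theorem Good.exists_subside {n k : ℕ} (hk : k < 3 * 4 ^ n) {z : ℂ} (h : Good n z)
    (hz : z ∈ openSide n k) : ∃ k' < 3 * 4 ^ (n + 1), z ∈ openSide (n + 1) k' ∧
      sideVec n k = sideVec (n + 1) k' * ((3 : ℝ) : ℂ) := by
  obtain ⟨l, hl, u, hu, rfl⟩ := h
  obtain ⟨k', hk', u', hu', h1, h2⟩ := exists_child_side hl hu
  obtain ⟨p1, p2⟩ := cantorCore_pos hu
  obtain ⟨q1, q2⟩ := cantorCore_pos hu'
  refine ⟨k', hk', by rw [h1]; exact mem_openSide_of_add q1 q2, ?_⟩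
  rw [← h2]
  exact sideVec_unique hk hl hz (mem_openSide_of_add p1 p2)

theorem reflect_mul_ofReal (s d : ℂ) {c : ℝ} (hc : c ≠ 0) :
    reflect (s * (c : ℂ)) d = reflect s d := by
  have : (c : ℂ) ≠ 0 := by exact_mod_cast hc
  unfold reflect
  rw [map_mul, Complex.conj_ofReal, mul_div_mul_right _ _ this]

/-- The flight stays in the larger open table, and the side that is hit is replaced near the
collision point by a parallel subside, which reflects in the same way. -/
theorem Step.succ {n : ℕ} {p q : ℂ × ℂ} (h : Step n p q) (hq : Good n q.1) : Step (n + 1) p q := by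
  obtain ⟨T, hT, e1, ho, k, hk, hz, e2⟩ := h
  obtain ⟨k', hk', hz', hs⟩ := hq.exists_subside hk hz
  exact ⟨T, hT, e1, fun t h0 h1 => openTable_subset_succ n (ho t h0 h1), k', hk', hz',
    by rw [e2, hs, reflect_mul_ofReal _ _ (by norm_num)]⟩

theorem IsInward.succ {n : ℕ} {x d : ℂ} (h : IsInward n x d) (hx : Good n x) :
    IsInward (n + 1) x d := by
  obtain ⟨k, hk, hz, him⟩ := h
  obtain ⟨k', hk', hz', hs⟩ := hx.exists_subside hk hz
  refine ⟨k', hk', hz', ?_⟩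
  rw [hs, map_mul, Complex.conj_ofReal, mul_right_comm, Complex.im_mul_ofReal] at him
  linarith

theorem exists_mem_orbit_step {n : ℕ} {p q : ℂ × ℂ} (h : TransGen (Step n) p p)
    (hq : q ∈ orbit n p) : ∃ q', Step n q q' := by
  have := (transGen_of_reflTransGen (R := Step n) (fun _ _ _ => step_unique) h hq).2
  obtain ⟨c, hc, -⟩ := TransGen.head'_iff.1 this
  exact ⟨c, hc⟩

/-- The orbit of a Cantor type point does not change when the table is refined. -/
theorem orbit_persists {N : ℕ} {b : State} (hb : Bdry N b) (hv : b.v ∈ cantorCore) {n : ℕ}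
    (hn : N ≤ n) : orbit n (ph N b) = orbit N (ph N b) ∧
      TransGen (Step n) (ph N b) (ph N b) ∧ IsInward n (ph N b).1 (ph N b).2 ∧
      openTable N ⊆ openTable n := by
  obtain ⟨v0, v1⟩ := cantorCore_pos hv
  have hper := transGen_self hb v0 v1
  have key : (∀ q ∈ orbit N (ph N b), Good n q.1) ∧
      (∀ q q', q ∈ orbit N (ph N b) → Step N q q' → Step n q q') ∧
      IsInward n (ph N b).1 (ph N b).2 ∧ openTable N ⊆ openTable n := by
    induction n, hn using Nat.le_induction with
    | base =>
      refine ⟨fun q hq => ?_, fun q q' _ h => h, hb.isInward v0 v1, subset_rfl⟩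
      obtain ⟨b', hb', rfl, hv'⟩ := exists_of_mem_orbit hb v0 v1 hq
      -- The parameter at any collision is `b.v` or `1 - b.v`, and the Cantor type set is symmetric.
      have hv'' : b'.v ∈ cantorCore := by
        rcases hv' with h | h <;> rw [h]
        exacts [hv, cantorCore_one_sub hv]
      obtain ⟨w0, w1⟩ := cantorCore_pos hv''
      obtain ⟨k, hk, -, -, he⟩ := hb'.exists_side w0 w1
      exact ⟨k, hk, b'.v, hv'', he⟩
    | succ n hn ih =>
      obtain ⟨h1, h2, h3, h4⟩ := ih
      exact ⟨fun q hq => (h1 q hq).succ,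
        fun q q' hq h => (h2 q q' hq h).succ (h1 q' (ReflTransGen.tail hq h)),
        h3.succ (h1 _ ReflTransGen.refl), h4.trans (openTable_subset_succ n)⟩
  obtain ⟨-, h2, h3, h4⟩ := key
  refine ⟨Set.Subset.antisymm ?_ ?_, ?_, h3, h4⟩
  · intro q hq
    induction hq with
    | refl => exact ReflTransGen.refl
    | @tail q q' _ hs ih =>
      -- By periodicity there is a step at level `N`, which is also one at level `n`; determinism
      -- identifies it with the given step.
      obtain ⟨q'', hs'⟩ := exists_mem_orbit_step hper ih
      rw [step_unique hs (h2 _ _ ih hs')]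
      exact ReflTransGen.tail ih hs'
  · intro q hq
    induction hq with
    | refl => exact ReflTransGen.refl
    | tail h hs ih => exact ReflTransGen.tail ih (h2 _ _ h hs)
  · have : ∀ q, TransGen (Step N) (ph N b) q → TransGen (Step n) (ph N b) q := by
      intro q hq
      induction hq with
      | single h => exact .single (h2 _ _ ReflTransGen.refl h)
      | tail h hs ih => exact .tail ih (h2 _ _ h.to_reflTransGen hs)
    exact this _ hper

/-! ### Time reversal -/

/-- The other inward direction with the same trajectory line, run through backwards. -/
def Rev (n : ℕ) (p p' : ℂ × ℂ) : Prop :=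
  ∃ k < 3 * 4 ^ n, p.1 ∈ openSide n k ∧ p'.1 = p.1 ∧ p'.2 = -reflect (sideVec n k) p.2

theorem reflect_reflect {s : ℂ} (hs : s ≠ 0) (d : ℂ) : reflect s (reflect s d) = d := by
  have : (starRingEnd ℂ) s ≠ 0 := by simpa using hs
  unfold reflect
  simp only [map_mul, map_div₀, Complex.conj_conj]
  field_simp

theorem reflect_neg (s d : ℂ) : reflect s (-d) = -reflect s d := by simp [reflect]

theorem sideVec_ne_zero (n k : ℕ) : sideVec n k ≠ 0 := by
  rw [sideVec_eq]
  exact mul_ne_zero (dir_ne_zero _) (by simp)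

theorem Rev.symm {n : ℕ} {p p' : ℂ × ℂ} (h : Rev n p p') : Rev n p' p := by
  obtain ⟨k, hk, hz, e1, e2⟩ := h
  exact ⟨k, hk, e1 ▸ hz, e1.symm,
    by rw [e2, reflect_neg, reflect_reflect (sideVec_ne_zero n k), neg_neg]⟩

theorem Rev.step {n : ℕ} {p q p' q' : ℂ × ℂ} (h : Step n p q) (hp : Rev n p p')
    (hq : Rev n q q') : Step n q' p' := by
  obtain ⟨T, hT, e1, ho, k, hk, hz, e2⟩ := h
  obtain ⟨l, hl, hz', e3, e4⟩ := hp
  obtain ⟨m, hm, hz'', e5, e6⟩ := hq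
  have e7 : q'.2 = -p.2 := by
    rw [e6, e2, sideVec_unique hm hk hz'' hz, reflect_reflect (sideVec_ne_zero n k)]
  refine ⟨T, hT, ?_, ?_, l, hl, e3 ▸ hz', ?_⟩
  · rw [e3, e5, e7, e1]; ring
  · intro t h0 h1
    have := ho (T - t) (by linarith) (by linarith)
    rw [e5, e7, e1]
    convert this using 1
    push_cast; ring
  · rw [e4, e7, reflect_neg]

theorem Rev.exists_of_step {n : ℕ} {p q : ℂ × ℂ} (h : Step n p q) : ∃ q', Rev n q q' := by
  obtain ⟨T, hT, e1, ho, k, hk, hz, e2⟩ := h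
  exact ⟨(q.1, -reflect (sideVec n k) q.2), k, hk, hz, rfl, rfl⟩

theorem Rev.unique {n : ℕ} {p q q' : ℂ × ℂ} (h : Rev n p q) (h' : Rev n p q') : q = q' := by
  obtain ⟨k, hk, hz, e1, e2⟩ := h
  obtain ⟨k', hk', hz', e1', e2'⟩ := h'
  exact Prod.ext (e1.trans e1'.symm) (by rw [e2, e2', sideVec_unique hk hk' hz hz'])

theorem Rev.reflTransGen {n : ℕ} {p q p' q' : ℂ × ℂ} (h : ReflTransGen (Step n) p q)
    (hp : Rev n p p') (hq : Rev n q q') : ReflTransGen (Step n) q' p' := by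
  induction h generalizing q' with
  | refl => rw [hp.unique hq]
  | tail _ hs ih =>
    rename_i r _ h1
    -- An intermediate phase point is either the start, whose reversal is given, or the result of a
    -- collision, so on an open side, where a reversal exists.
    rcases ReflTransGen.cases_tail h1 with h | ⟨c, -, hc⟩
    · subst h
      exact .head (Rev.step hs hp hq) .refl
    · obtain ⟨r', hr⟩ := Rev.exists_of_step hc
      exact .head (Rev.step hs hr hq) (ih hr)

theorem Rev.transGen {n : ℕ} {p p' : ℂ × ℂ} (h : TransGen (Step n) p p) (hp : Rev n p p') :
    TransGen (Step n) p' p' := by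
  obtain ⟨c, hc, hcp⟩ := TransGen.head'_iff.1 h
  obtain ⟨c', hc'⟩ := Rev.exists_of_step hc
  exact TransGen.tail' (Rev.reflTransGen hcp hc' hp) (Rev.step hc hp hc')

theorem Rev.exists_of_mem_orbit {n : ℕ} {p p' q : ℂ × ℂ} (h : TransGen (Step n) p p)
    (hp : Rev n p p') (hq : q ∈ orbit n p) : ∃ q' ∈ orbit n p', Rev n q q' := by
  obtain ⟨hqp, hqq⟩ := transGen_of_reflTransGen (R := Step n) (fun _ _ _ => step_unique) h hq
  obtain ⟨c, -, hc⟩ := TransGen.tail'_iff.1 hqq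
  obtain ⟨q', hq'⟩ := Rev.exists_of_step hc
  exact ⟨q', Rev.reflTransGen hqp hq' hp, hq'⟩

theorem Rev.footprint_eq {n : ℕ} {p p' : ℂ × ℂ} (h : TransGen (Step n) p p) (hp : Rev n p p') :
    footprint n p' = footprint n p := by
  have key : ∀ {p p' : ℂ × ℂ}, TransGen (Step n) p p → Rev n p p' →
      footprint n p ⊆ footprint n p' := by
    rintro p p' h hp _ ⟨q, hq, rfl⟩
    obtain ⟨q', hq', k, -, -, e, -⟩ := Rev.exists_of_mem_orbit h hp hq
    exact ⟨q', hq', e⟩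
  exact (key (Rev.transGen h hp) hp.symm).antisymm (key h hp)

theorem Rev.path_eq {n : ℕ} {p p' : ℂ × ℂ} (h : TransGen (Step n) p p) (hp : Rev n p p') :
    path n p' = path n p := by
  have key : ∀ {p p' : ℂ × ℂ}, TransGen (Step n) p p → Rev n p p' →
      path n p ⊆ path n p' := by
    rintro p p' h hp z ⟨q, hq, r, hs, hz⟩
    obtain ⟨q', hq', hrq⟩ := Rev.exists_of_mem_orbit h hp hq
    obtain ⟨r', hr', hrr⟩ := Rev.exists_of_mem_orbit h hp (ReflTransGen.tail hq hs)
    refine ⟨r', hr', q', Rev.step hs hrq hrr, ?_⟩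
    obtain ⟨-, -, -, e, -⟩ := hrq
    obtain ⟨-, -, -, e', -⟩ := hrr
    rwa [e, e', segment_symm]
  exact (key (Rev.transGen h hp) hp.symm).antisymm (key h hp)

/-! ### Starting points over the base and assembly of the compatible sequence -/

theorem tri_base {n : ℕ} {p : ℤ} (h0 : 0 ≤ p) (h1 : p < 3 ^ n) : Tri n ⟨p, 0, -1 - p⟩ := by
  have h3 : (0 : ℤ) < 3 ^ n := by positivity
  have hv : (⟨p, 0, -1 - p⟩ : Tile).Valid := Or.inl (by simp [Tile.sum])
  have := Tri.of_anc (m := 0) (K := n) hv (by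
    rw [anc_eq]
    simp only [Tri, Tile.mk.injEq]
    refine ⟨Int.ediv_eq_zero_of_lt h0 h1, Int.zero_ediv _, ?_⟩
    rw [Int.ediv_eq_iff_of_pos h3]
    constructor <;> linarith)
  rwa [zero_add] at this

theorem ent_base (n : ℕ) (p : ℤ) (v : ℝ) :
    ent n ⟨⟨p, 0, -1 - p⟩, 0, v⟩ = (((p + v) / 3 ^ n : ℝ) : ℂ) := by
  simp [ent, pos, entA, entB, Tile.sum]

/-- The boundary point from which a point of the base is reached is as required of a member of a
compatible sequence of periodic orbits. -/
theorem Straight.isCompatible {n : ℕ} {b : State} {p : ℤ} {v : ℝ} (h0 : 0 ≤ p) (h1 : p < 3 ^ n)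
    (v0 : 0 < v) (v1 : v < 1) (hb : Bdry n b) (h : Straight n b ⟨⟨p, 0, -1 - p⟩, 0, v⟩) :
    ph n b = (ent n b, dir 1) ∧
    IsCompatible n (dir 1) (((p + v) / 3 ^ n : ℝ) : ℂ) (ent n b) ∧
    (n = 0 → ent n b = (((p + v) / 3 ^ n : ℝ) : ℂ)) := by
  have hd : b.d = 0 := h.d_eq.symm
  have hv : b.v = v := h.v_eq.symm
  rw [← hv] at v0 v1
  obtain ⟨T, hT, he, ho, -⟩ := h.path hb.1 v0 v1
  obtain ⟨k, hk, -, hz, -⟩ := hb.exists_side v0 v1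
  rw [ent_base, hd, D_zero] at he
  rw [hd, D_zero] at ho
  refine ⟨by rw [ph, hd, D_zero], ⟨openSide_subset_curve hk hz, T, hT, he, ho⟩, ?_⟩
  rintro rfl
  -- At level `0` the base is itself a side of the table, so there is no way to go back.
  obtain rfl : p = 0 := by rw [pow_zero] at h1; omega
  rw [← ent_base, ← h.eq_of_bdry hb.1 ⟨rfl, prv_ne _ _⟩]

end KochBilliard

open KochBilliard Relation in
theorem mainTheorem9 (N k : ℕ) (hk : k < 3 * 4 ^ N) (y : ℂ)
    (hy : y ∈ KochBilliard.sideCantorPrime N k) (j : ℤ)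
    (hj : KochBilliard.IsInward N y (KochBilliard.dir j)) :
    ∃ x : ℕ → ℂ,
      KochBilliard.IsCantorBase (x 0) ∧
      KochBilliard.IsCompatiblePeriodicSeq (KochBilliard.dir 1) x ∧
      (∃ M : ℕ, KochBilliard.IsConstantFrom (KochBilliard.dir 1) x M ∧
        ∀ n, M ≤ n → KochBilliard.IsStabilizingOrbit n
          (KochBilliard.orbit n (x n, KochBilliard.dir 1))) ∧
      KochBilliard.IsPeriodicOrbit N (y, KochBilliard.dir j) ∧
      KochBilliard.path N (y, KochBilliard.dir j) =
        KochBilliard.path N (x N, KochBilliard.dir 1) ∧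
      KochBilliard.footprint N (y, KochBilliard.dir j) =
        KochBilliard.footprint N (x N, KochBilliard.dir 1) ∧
      (Odd j → KochBilliard.orbit N (y, KochBilliard.dir j) =
        KochBilliard.orbit N (x N, KochBilliard.dir 1)) := by
  obtain ⟨u, hu, rfl⟩ := hy
  have hu := cantorPrime_subset hu
  obtain ⟨u0, u1⟩ := cantorCore_pos hu
  obtain ⟨hT, hP⟩ := sideState_spec N k hk
  obtain ⟨k', hk', hz', him⟩ := hj
  have hz := mem_openSide_of_add (n := N) (k := k) u0 u1
  have hy := vertex_add_sideVec N k u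
  dsimp only at hz' ⊢
  have hs' : sideState N k' = sideState N k := by
    rw [hy] at hz'
    exact sideState_eq_of_mem hk' hT.valid hP u0 u1 hz'
  rw [conj_sideVec_mul_im, hs'] at him
  -- Exactly two multiples of `π/3` are inward, at angles `π/3` and `2π/3` to the side. One has odd
  -- index and is the direction of `b₀`; the other is its time reversal.
  have hj := (dir_im_pos_iff _).1 (pos_of_mul_pos_right him (by positivity))
  set b₀ : State := ⟨(sideState N k).1, (sideState N k).2, u⟩ with hb₀
  have hbd : Bdry N b₀ := ⟨hT, hP⟩
  have hper := transGen_self hbd u0 u1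
  obtain ⟨p, v, p0, p1, hr⟩ := exists_reaches_base (sideState N k).2 u hT
  have hv : v ∈ cantorCore := by
    obtain ⟨i, hi⟩ := hr
    have := flow_iterate_v N b₀ i
    rw [hi] at this
    rcases this with h | h <;> dsimp only [b₀] at h <;> rw [h]
    exacts [hu, cantorCore_one_sub hu]
  obtain ⟨v0, v1⟩ := cantorCore_pos hv
  set x₀ : ℂ := (((p + v) / 3 ^ N : ℝ) : ℂ) with hx₀
  have hbase : IsCantorBase x₀ := isCantorBase_of_cantorCore p0 p1 hv
  have hTI := tri_base p0 p1
  obtain ⟨b, hb, hst⟩ := exists_straight ⟨⟨p, 0, -1 - p⟩, 0, v⟩ hTI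
  obtain ⟨hph, hcomp, hzero⟩ := hst.isCompatible p0 p1 v0 v1 hb
  have hbv : b.v = v := hst.v_eq.symm
  -- The orbit of `y` reaches the base state, which lies straight ahead of `b`; symmetry of
  -- reachability leads on to `b`.
  have hreach : Reaches N b₀ b := hr.trans (hst.reaches.symm hb.1)
  have hmem : ph N b ∈ orbit N (ph N b₀) := hreach.reflTransGen hbd hb u0 u1
  have horb := orbit_eq hper hmem
  -- This supplies the members below level `N`; there the orbit of `y` plays no role, only that `x₀`
  -- is interior to an edge of every lattice.
  have hex : ∀ n, ∃ x, IsCompatible n (dir 1) x₀ x ∧ IsInward n x (dir 1) ∧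
      IsPeriodicOrbit n (x, dir 1) ∧ (n = 0 → x = x₀) := by
    intro n
    obtain ⟨q, w, q0, q1, w0, w1, hq⟩ := hbase.exists_eq n
    obtain ⟨c, hc, hsc⟩ := exists_straight ⟨⟨q, 0, -1 - q⟩, 0, w⟩ (tri_base q0 q1)
    obtain ⟨h1, h2, h3⟩ := hsc.isCompatible q0 q1 w0 w1 hc
    have hcv : c.v = w := hsc.v_eq.symm
    rw [← hcv] at w0 w1
    have h4 := hc.isInward w0 w1
    have h5 := transGen_self hc w0 w1
    rw [h1] at h5
    have h6 : D c.d = dir 1 := congrArg Prod.snd h1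
    rw [h6] at h4
    rw [hq]
    exact ⟨_, h2, h4, h5, h3⟩
  choose X hX using hex
  have hhigh : ∀ n, N ≤ n → IsCompatible n (dir 1) x₀ (ent N b) ∧ IsInward n (ent N b) (dir 1) ∧
      IsPeriodicOrbit n (ent N b, dir 1) ∧
      orbit n (ent N b, dir 1) = orbit N (ent N b, dir 1) := by
    intro n hn
    obtain ⟨h1, h2, h3, h4⟩ := orbit_persists hb (hbv ▸ hv) hn
    rw [hph] at h1 h2 h3
    obtain ⟨-, T, hT, he, ho⟩ := hcomp
    refine ⟨⟨?_, T, hT, he, fun t h h' => h4 (ho t h h')⟩, h3, h2, h1⟩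
    obtain ⟨l, hl, hzl, -⟩ := h3
    exact openSide_subset_curve hl hzl
  set x : ℕ → ℂ := fun n => if n < N then X n else ent N b with hx
  have hxlow : ∀ n, n < N → x n = X n := fun n hn => if_pos hn
  have hxhigh : ∀ n, N ≤ n → x n = ent N b := fun n hn => if_neg (by omega)
  have hx0 : x 0 = x₀ := by
    rcases Nat.eq_zero_or_pos N with h | h
    · rw [hxhigh 0 (by omega)]
      exact hzero h
    · rw [hxlow 0 h]
      exact (hX 0).2.2.2 rfl
  have hseq : IsCompatiblePeriodicSeq (dir 1) x := by
    refine ⟨fun n => ?_, fun n => ?_⟩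
    · rw [hx0]
      rcases lt_or_ge n N with h | h
      · rw [hxlow n h]; exact ⟨(hX n).1, (hX n).2.1⟩
      · rw [hxhigh n h]; exact ⟨(hhigh n h).1, (hhigh n h).2.1⟩
    · rcases lt_or_ge n N with h | h
      · rw [hxlow n h]; exact (hX n).2.2.1
      · rw [hxhigh n h]; exact (hhigh n h).2.2.1
  have hconst : ∀ M, N ≤ M → IsConstantFrom (dir 1) x M := by
    intro M hM n hn
    rw [hxhigh n (hM.trans hn), hxhigh M hM, (hhigh n (hM.trans hn)).2.2.2, (hhigh M hM).2.2.2]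
  rw [← hx0] at hbase
  refine ⟨x, hbase, hseq, ⟨N, hconst N le_rfl, fun n hn => ⟨x, hbase, hseq, hconst n hn, rfl⟩⟩, ?_⟩
  rw [hxhigh N le_rfl, ← hph, hy]
  have hpath : path N (ph N b) = path N (ph N b₀) := by unfold path; rw [horb]
  have hfoot : footprint N (ph N b) = footprint N (ph N b₀) := by unfold footprint; rw [horb]
  rw [hpath, hfoot, horb]
  rcases Int.even_or_odd j with hje | hjo
  -- For even `j` the direction is the reversed one, which gives the same path and collision points
  -- but no claim about the directions.
  · have hdir : dir j = -reflect (sideVec N k) (D b₀.d) := by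
      rw [sideVec_eq, D, reflect_dir _ _ (by positivity), ← neg_one_mul, ← dir_three, ← dir_add]
      apply dir_eq_of_dvd
      rcases hT.valid with h | h <;> simp only [edgeDir, h, hb₀] at hj ⊢ <;>
        rw [Int.even_iff] at hje <;> omega
    have hrev : Rev N (ph N b₀) (ent N b₀, dir j) :=
      ⟨k, hk, by dsimp only [ph]; rwa [hy] at hz, rfl, hdir⟩
    exact ⟨Rev.transGen hper hrev, Rev.path_eq hper hrev, Rev.footprint_eq hper hrev,
      fun h => absurd hje (Int.not_even_iff_odd.2 h)⟩
  · have hdir : dir j = D b₀.d := by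
      rw [D]
      apply dir_eq_of_dvd
      rcases hT.valid with h | h <;> simp only [edgeDir, h, hb₀] at hj ⊢ <;>
        rw [Int.odd_iff] at hjo <;> omega
    rw [hdir]
    exact ⟨hper, rfl, rfl, fun _ => rfl⟩
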